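/- Let $M$ be a smooth manifold of dimension $n\ge 3$ with a smooth Lorentzian metric $g$ of signature $(-,+,\ldots,+)$ and Levi-Civita connection $\nabla$, and let $K$ be a smooth timelike vector field on $M$, i.e. $g(K_p,K_p)<0$ for all $p\in M$. Let $\pi:TM\to M$ be the tangent bundle and $$C_KM=\{v\in TM : g(v,v)=0,\ g(v,K_{\pi(v)})=-1\}$$ the null congruence associated with $K$, an embedded submanifold of $TM$ of dimension $2(n-1)$. Let $c:TTM\to TM$ be the connection map of $\nabla$: $c(\xi)=\frac{\nabla\alpha}{dt}(0)$ for any curve $\alpha$ in $TM$ with $\alpha'(0)=\xi$, where $\frac{\nabla\alpha}{dt}$ is the covariant derivative of $\alpha$ as a vector field along $\pi\circ\alpha$. Equip $C_KM$ with the metric $\widehat g$ induced by the Sasaki metric $$\widehat g(\zeta,\xi)=g(d\pi(\zeta),d\pi(\xi))+g(c(\zeta),c(\xi))$$ of $TM$, so that $\pi|_{C_KM}:(C_KM,\widehat g)\to(M,g)$ is a semi-Riemannian submersion. Then the fibres $(C_KM)_p=C_KM\cap T_pM$, $p\in M$, are all totally geodesic in $(C_KM,\widehat g)$ (that is, their second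 fundamental forms with respect to the Levi-Civita connection of $(C_KM,\widehat g)$ vanish) if and only if $K$ is parallel (that is, $\nabla_uK=0$ for every tangent vector $u$ of $M$). -/

import Mathlib

open scoped Manifold ContDiff
open Bundle

namespace NullCongruence

noncomputable section

/-! ### Levi-Civita calculus in coordinates -/

section Coordinates

variable {V : Type*} [NormedAddCommGroup V] [NormedSpace ℝ V]

/-- Christoffel symbols (of the second kind) of a metric tensor `G` on an open subset of `V`:
`christoffel G x v u = Γ_x(u, v)` is the vector determined by
`2 G_x(Γ_x(u, v), w) = (∂_u G)(v, w) + (∂_v G)(u, w) - (∂_w G)(u, v)` for all `w`. -/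
def christoffel (G : V → V →L[ℝ] V →L[ℝ] ℝ) (x v : V) : V →L[ℝ] V :=
  (G x).inverse ∘L ((1 / 2 : ℝ) •
    ((fderiv ℝ G x).flip v + fderiv ℝ G x v - ((fderiv ℝ G x).flip v).flip))

/-- The Levi-Civita covariant derivative of the metric tensor `G` on an open subset of `V`:
`covDeriv G Y x u = (∇_u Y)(x) = (∂_u Y)(x) + Γ_x(u, Y x)`. -/
def covDeriv (G : V → V →L[ℝ] V →L[ℝ] ℝ) (Y : V → V) (x : V) : V →L[ℝ] V :=
  fderiv ℝ Y x + christoffel G x (Y x)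

end Coordinates

/-! ### Pull-backs of bilinear forms and local parametrizations of subsets of a manifold -/

section Parametrizations

variable {V : Type*} [NormedAddCommGroup V] [NormedSpace ℝ V]
  {F : Type*} [NormedAddCommGroup F] [NormedSpace ℝ F]
  {H : Type*} [TopologicalSpace H] {J : ModelWithCorners ℝ F H}
  {N : Type*} [TopologicalSpace N] [ChartedSpace H N]

/-- The pull-back `φ^* B` of a field `B` of bilinear forms on `N` along a map `φ` from a vector
space `V`: `(φ^* B)_w (a, b) = B (dφ_w a, dφ_w b)`. -/
def pullbackForm (φ : V → N) (B : ∀ x : N, TangentSpace J x →L[ℝ] TangentSpace J x →L[ℝ] ℝ)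
    (w : V) : V →L[ℝ] V →L[ℝ] ℝ :=
  let D : V →L[ℝ] TangentSpace J (φ w) := mfderiv 𝓘(ℝ, V) J φ w
  D.precomp ℝ ∘L B (φ w) ∘L D

variable (J) in
/-- `φ`, restricted to the open set `W`, is a local parametrization of the subset `S` of the
manifold `N`, regarded as an embedded submanifold: a smooth immersion which is a homeomorphism from
`W` onto an open subset of `S`. -/
structure IsLocalParametrization (S : Set N) (W : Set V) (φ : V → N) : Prop where
  isOpen : IsOpen W
  contMDiffOn : ContMDiffOn 𝓘(ℝ, V) J ∞ φ W
  injective_mfderiv : ∀ w ∈ W, Function.Injective (mfderiv 𝓘(ℝ, V) J φ w)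
  mapsTo : Set.MapsTo φ W S
  isOpenEmbedding : Topology.IsOpenEmbedding (mapsTo.restrict φ W S)

end Parametrizations

/-! ### Lorentzian metrics and their Levi-Civita connection -/

/-- A smooth Lorentzian metric on the `n`-dimensional smooth manifold `M`: a smooth field of
symmetric bilinear forms of signature `(-, +, …, +)`. -/
structure LorentzianMetric (n : ℕ) (M : Type*) [TopologicalSpace M]
    [ChartedSpace (EuclideanSpace ℝ (Fin n)) M] [IsManifold (𝓡 n) ∞ M] where
  /-- The bilinear form on each tangent space. -/
  form : ∀ p : M, TangentSpace (𝓡 n) p →L[ℝ] TangentSpace (𝓡 n) p →L[ℝ] ℝ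
  symm : ∀ (p : M) (u v : TangentSpace (𝓡 n) p), form p u v = form p v u
  signature : ∀ p : M, ∃ t : TangentSpace (𝓡 n) p, form p t t < 0 ∧
    ∀ u : TangentSpace (𝓡 n) p, form p t u = 0 → u ≠ 0 → 0 < form p u u
  contMDiff : ContMDiff (𝓡 n)
    ((𝓡 n).prod 𝓘(ℝ, EuclideanSpace ℝ (Fin n) →L[ℝ] EuclideanSpace ℝ (Fin n) →L[ℝ] ℝ)) ∞
    (fun p ↦ TotalSpace.mk' (EuclideanSpace ℝ (Fin n) →L[ℝ] EuclideanSpace ℝ (Fin n) →L[ℝ] ℝ)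
      (E := fun p : M ↦ TangentSpace (𝓡 n) p →L[ℝ] TangentSpace (𝓡 n) p →L[ℝ] ℝ) p (form p))

variable {n : ℕ} {M : Type*} [TopologicalSpace M] [ChartedSpace (EuclideanSpace ℝ (Fin n)) M]

/-- The differential at `x` of the chart around `p`: it sends a tangent vector at `x` to its
components in this chart. -/
def components (p x : M) : TangentSpace (𝓡 n) x →L[ℝ] EuclideanSpace ℝ (Fin n) :=
  mvfderiv (𝓡 n) (extChartAt (𝓡 n) p) x

variable [IsManifold (𝓡 n) ∞ M]

/-- The metric written in the chart around `p`. -/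
def LorentzianMetric.inChart (g : LorentzianMetric n M) (p : M) : EuclideanSpace ℝ (Fin n) →
    EuclideanSpace ℝ (Fin n) →L[ℝ] EuclideanSpace ℝ (Fin n) →L[ℝ] ℝ :=
  pullbackForm (J := 𝓡 n) (extChartAt (𝓡 n) p).symm g.form

/-- The Levi-Civita covariant derivative `u ↦ ∇_u Y` at `p` of the vector field `Y` on `M`,
computed in the chart around `p`. -/
def LorentzianMetric.nabla (g : LorentzianMetric n M) (Y : ∀ p : M, TangentSpace (𝓡 n) p) (p : M) :
    TangentSpace (𝓡 n) p →L[ℝ] TangentSpace (𝓡 n) p :=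
  (components p p).inverse ∘L
    covDeriv (g.inChart p)
      (fun y ↦ components p ((extChartAt (𝓡 n) p).symm y) (Y ((extChartAt (𝓡 n) p).symm y)))
      (extChartAt (𝓡 n) p p) ∘L
    components p p

/-- The vector field `K` is timelike. -/
def LorentzianMetric.IsTimelike (g : LorentzianMetric n M) (K : ∀ p : M, TangentSpace (𝓡 n) p) :
    Prop :=
  ∀ p, g.form p (K p) (K p) < 0

/-- The vector field `K` is parallel: `∇_u K = 0` for every tangent vector `u`. -/
def LorentzianMetric.IsParallel (g : LorentzianMetric n M) (K : ∀ p : M, TangentSpace (𝓡 n) p) :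
    Prop :=
  ∀ (p : M) (u : TangentSpace (𝓡 n) p), g.nabla K p u = 0

/-! ### The Sasaki metric on the tangent bundle -/

/-- The differential `ξ ↦ ξ_⋆` at `v` of the projection `π : TM → M`. -/
def dproj (v : TangentBundle (𝓡 n) M) :
    TangentSpace (𝓡 n).tangent v →L[ℝ] TangentSpace (𝓡 n) v.proj :=
  mfderiv (𝓡 n).tangent (𝓡 n) (TotalSpace.proj : TangentBundle (𝓡 n) M → M) v

/-- The connection map `c : T_v TM → T_{π(v)} M` of the Levi-Civita connection. If `α` is a curve in
`TM` with `α'(0) = ξ`, then `c(ξ)` is the covariant derivative at `0` of `α` as a vector field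
along `γ = π ∘ α`; in the chart around `π(v)` its components are `(d/dt) a + Γ(γ', a)` at `0`, where
`a(t)` are the components of `α(t)`. -/
def LorentzianMetric.connector (g : LorentzianMetric n M) (v : TangentBundle (𝓡 n) M) :
    TangentSpace (𝓡 n).tangent v →L[ℝ] TangentSpace (𝓡 n) v.proj :=
  let p : M := v.proj
  let dcomp : TangentSpace (𝓡 n).tangent v →L[ℝ] EuclideanSpace ℝ (Fin n) :=
    mvfderiv (𝓡 n).tangent (fun v' : TangentBundle (𝓡 n) M ↦ components p v'.proj v'.snd) v
  (components p p).inverse ∘L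
    (dcomp + christoffel (g.inChart p) (extChartAt (𝓡 n) p p) (components p p v.snd) ∘L
      components p p ∘L dproj v)

/-- The Sasaki metric `ĝ(ζ, ξ) = g(ζ_⋆, ξ_⋆) + g(c(ζ), c(ξ))` on `TM`. -/
def LorentzianMetric.sasaki (g : LorentzianMetric n M) (v : TangentBundle (𝓡 n) M) :
    TangentSpace (𝓡 n).tangent v →L[ℝ] TangentSpace (𝓡 n).tangent v →L[ℝ] ℝ :=
  (dproj v).precomp ℝ ∘L g.form v.proj ∘L dproj v +
    (g.connector v).precomp ℝ ∘L g.form v.proj ∘L g.connector v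

/-! ### The null congruence and its fibres -/

/-- The null congruence `C_K M ⊆ TM` associated with the vector field `K`. -/
def LorentzianMetric.nullCongruence (g : LorentzianMetric n M)
    (K : ∀ p : M, TangentSpace (𝓡 n) p) : Set (TangentBundle (𝓡 n) M) :=
  {v | g.form v.proj v.snd v.snd = 0 ∧ g.form v.proj v.snd (K v.proj) = -1}

variable {V : Type*} [NormedAddCommGroup V] [NormedSpace ℝ V]

/-- In a local parametrization `φ` of the null congruence, the vector `u` at the parameter `w` is
vertical, i.e. tangent to the fibre of `π` through `φ w`. -/
def IsVertical (φ : V → TangentBundle (𝓡 n) M) (w u : V) : Prop :=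
  dproj (φ w) (mfderiv 𝓘(ℝ, V) (𝓡 n).tangent φ w u) = 0

/-- In a local parametrization `φ` of the null congruence, the vector `z` at the parameter `w` is
horizontal, i.e. normal to the fibre of `π` through `φ w` for the metric induced by the Sasaki
metric. -/
def LorentzianMetric.IsHorizontal (g : LorentzianMetric n M) (φ : V → TangentBundle (𝓡 n) M)
    (w z : V) : Prop :=
  ∀ u : V, IsVertical φ w u → pullbackForm (J := (𝓡 n).tangent) φ g.sasaki w u z = 0

/-- The fibres of `π : C_K M → M` are totally geodesic in `C_K M` with the metric induced by the
Sasaki metric: their second fundamental form vanishes. That is, in every local parametrization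
`φ : W → C_K M` of the `2(n-1)`-dimensional submanifold `C_K M`, if `∇̂` is the Levi-Civita
connection of the induced metric `φ^* ĝ`, then `∇̂_u U` has no component normal to the fibre, for
every vertical vector `u` and every smooth vertical vector field `U`. -/
def LorentzianMetric.FibresTotallyGeodesic (g : LorentzianMetric n M)
    (K : ∀ p : M, TangentSpace (𝓡 n) p) : Prop :=
  ∀ (W : Set (EuclideanSpace ℝ (Fin (2 * (n - 1)))))
    (φ : EuclideanSpace ℝ (Fin (2 * (n - 1))) → TangentBundle (𝓡 n) M),
    IsLocalParametrization (𝓡 n).tangent (g.nullCongruence K) W φ →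
    ∀ U : EuclideanSpace ℝ (Fin (2 * (n - 1))) → EuclideanSpace ℝ (Fin (2 * (n - 1))),
      ContDiffOn ℝ ∞ U W → (∀ w ∈ W, IsVertical φ w (U w)) →
      ∀ w ∈ W, ∀ u, IsVertical φ w u → ∀ z, g.IsHorizontal φ w z →
        pullbackForm (J := (𝓡 n).tangent) φ g.sasaki w
          (covDeriv (pullbackForm (J := (𝓡 n).tangent) φ g.sasaki) U w u) z = 0

end

end NullCongruence

/-! Write a tangent vector of `TM` at `v` as the pair `(d, b)` of its projection and its image under
the connection map. Differentiating `g(v, v) = 0` and `g(v, K) = -1` shows that the tangent space of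
the null congruence is cut out by `g(v, b) = 0` and `g(b, K) = -g(v, ∇_d K)`; a dimension count
makes this an equality (`exists_tangent`). Vertical vectors are the pairs `(0, b)` with `b`
orthogonal to `v` and `K`, and such `b` are spacelike. Hence the horizontal vector over `d` has
connection part `λ v` with `λ = g(v, ∇_d K)` (`covDerivAlong_of_horizontal`).

Let `u`, `U` be vertical and `z` horizontal over `d`. The Koszul formula for `ĝ` reduces to `ĝ(∇̂_u
U, z) = g(∂_u (c U), c z)`, because the curvature of the connection map does not see vertical
directions. Since `c z = λ v` and `g(v, c U) = 0` along the fibre, moving the derivative to `v`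
gives `ĝ(∇̂_u U, z) = -g(c u, c U) g(v, ∇_d K)` (`sasakiAlong_covDeriv`).

If `K` is parallel this vanishes. Conversely, as `n ≥ 3` the fibres have positive dimension, so
taking `U` equal to a nonzero vertical `u` makes the first factor positive. Thus `g(v, ∇_d K) = 0`
for all `v` in the congruence over a point, and such `v` span the tangent space (`eq_zero_of_null`),
so `∇_d K = 0`.

The computation takes place in one fixed chart. The Sasaki metric is defined at each `v` through the
chart at `π v`, so its chart independence is needed before it can be differentiated
(`pullbackForm_sasaki_eq`). The converse also needs actual parametrizations, obtained from the
inverse function theorem (`exists_isLocalParametrization`). -/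

namespace NullCongruence

open scoped Topology
open Filter

noncomputable section

set_option maxSynthPendingDepth 3

/-! ### Lorentzian bilinear forms -/

section LorentzianForms

variable {E : Type*} [NormedAddCommGroup E] [NormedSpace ℝ E]

/-- A symmetric bilinear form of signature `(-, +, …, +)`. -/
structure IsLorentzianForm (B : E →L[ℝ] E →L[ℝ] ℝ) : Prop where
  symm : ∀ u v, B u v = B v u
  signature : ∃ t, B t t < 0 ∧ ∀ u, B t u = 0 → u ≠ 0 → 0 < B u u

variable {B : E →L[ℝ] E →L[ℝ] ℝ}

/-- The orthogonal complement of a timelike vector is spacelike. -/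
theorem IsLorentzianForm.pos_of_orthogonal (hB : IsLorentzianForm B) {k u : E} (hk : B k k < 0)
    (hku : B k u = 0) (hu : u ≠ 0) : 0 < B u u := by
  obtain ⟨t, ht, hpos⟩ := hB.signature
  by_contra! hle
  -- Otherwise `k` would be orthogonal to `t`, hence spacelike.
  have hkt : B t k ≠ 0 := fun h ↦ by
    have hk0 : k ≠ 0 := by rintro rfl; simp at hk
    linarith [hpos k h hk0]
  have huk : B u k = 0 := by rw [hB.symm, hku]
  -- The combination of `k` and `u` orthogonal to `t`: it must be spacelike, while `B w w` is a sum
  -- of two nonpositive terms.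
  set w : E := B t u • k - B t k • u with hw
  have hw0 : w ≠ 0 := fun h ↦ by
    have h1 : B k w = 0 := by rw [h]; simp
    simp only [hw, map_sub, map_smul, hku, smul_eq_mul, mul_zero, sub_zero, mul_eq_zero,
      hk.ne, or_false] at h1
    rw [hw, h1, zero_smul, zero_sub, neg_eq_zero, smul_eq_zero] at h
    exact h.elim hkt hu
  have h2 := hpos w (by simp [hw]; ring) hw0
  have h3 : B w w = (B t u) ^ 2 * B k k + (B t k) ^ 2 * B u u := by
    simp [hw, hku, huk]; ring
  nlinarith [mul_nonneg (sq_nonneg (B t u)) (neg_nonneg.2 hk.le),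
    mul_nonneg (sq_nonneg (B t k)) (neg_nonneg.2 hle)]

theorem IsLorentzianForm.eq_zero_of_forall (hB : IsLorentzianForm B) {u : E} (h : ∀ v, B u v = 0) :
    u = 0 := by
  obtain ⟨t, ht, hpos⟩ := hB.signature
  by_contra hu
  linarith [hpos u (by rw [hB.symm, h]) hu, h u]

/-- An injective continuous bilinear form on a finite-dimensional space is invertible. -/
theorem isInvertible_of_nondegenerate [FiniteDimensional ℝ E]
    (h : ∀ u, (∀ v, B u v = 0) → u = 0) : B.IsInvertible := by
  have hinj : Function.Injective (B : E →ₗ[ℝ] E →L[ℝ] ℝ) :=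
    (injective_iff_map_eq_zero _).2 fun u hu ↦ h u fun v ↦ by
      simpa using congrArg (fun f : E →L[ℝ] ℝ ↦ f v) hu
  have hdim : Module.finrank ℝ E = Module.finrank ℝ (E →L[ℝ] ℝ) := by
    rw [← (LinearMap.toContinuousLinearMap (𝕜 := ℝ) (E := E) (F' := ℝ)).finrank_eq]
    exact (Subspace.dual_finrank_eq (K := ℝ) (V := E)).symm
  refine ⟨(LinearMap.linearEquivOfInjective _ hinj hdim).toContinuousLinearEquiv, ?_⟩
  ext u v
  rfl

theorem IsLorentzianForm.isInvertible [FiniteDimensional ℝ E] (hB : IsLorentzianForm B) :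
    B.IsInvertible :=
  isInvertible_of_nondegenerate fun _ ↦ hB.eq_zero_of_forall

end LorentzianForms

/-! ### Christoffel symbols -/

section Christoffel

variable {V : Type*} [NormedAddCommGroup V] [NormedSpace ℝ V] {G : V → V →L[ℝ] V →L[ℝ] ℝ} {x : V}

/-- The Koszul formula. Invertibility is essential: `inverse` takes the value zero on maps that are
not invertible. -/
theorem christoffel_apply (hG : (G x).IsInvertible) (v u w : V) :
    G x (christoffel G x v u) w =
      1 / 2 * (fderiv ℝ G x u v w + fderiv ℝ G x v u w - fderiv ℝ G x w v u) := by
  simp only [christoffel, ContinuousLinearMap.comp_apply]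
  rw [hG.self_apply_inverse]
  simp

theorem fderiv_form_symm (hG : DifferentiableAt ℝ G x)
    (hs : ∀ᶠ y in 𝓝 x, ∀ u v, G y u v = G y v u) (d u v : V) :
    fderiv ℝ G x d u v = fderiv ℝ G x d v u := by
  have h (a b : V) : HasFDerivAt (fun y ↦ G y a b)
      (((ContinuousLinearMap.apply ℝ ℝ b) ∘L (ContinuousLinearMap.apply ℝ _ a)) ∘L
        fderiv ℝ G x) x :=
    ((ContinuousLinearMap.apply ℝ ℝ b) ∘L
      (ContinuousLinearMap.apply ℝ (V →L[ℝ] ℝ) a)).hasFDerivAt.comp x hG.hasFDerivAt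
  have h2 := (h v u).congr_of_eventuallyEq (f₁ := fun y ↦ G y u v) (hs.mono fun y hy ↦ hy u v)
  simpa using DFunLike.congr_fun ((h u v).unique h2) d

/-- The Levi-Civita connection is compatible with the metric. -/
theorem fderiv_form_eq_christoffel (hG : DifferentiableAt ℝ G x) (hi : (G x).IsInvertible)
    (hs : ∀ᶠ y in 𝓝 x, ∀ u v, G y u v = G y v u) (d u v : V) :
    fderiv ℝ G x d u v = G x (christoffel G x u d) v + G x u (christoffel G x v d) := by
  rw [hs.self_of_nhds u, christoffel_apply hi, christoffel_apply hi,
    fderiv_form_symm hG hs d v u, fderiv_form_symm hG hs u v d, fderiv_form_symm hG hs v u d]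
  ring

/-- The Christoffel symbols as a bilinear map. -/
def christoffelCLM (G : V → V →L[ℝ] V →L[ℝ] ℝ) (x : V) : V →L[ℝ] V →L[ℝ] V :=
  (ContinuousLinearMap.compL ℝ V (V →L[ℝ] ℝ) V (G x).inverse) ∘L ((1 / 2 : ℝ) •
    ((ContinuousLinearMap.flipₗᵢ ℝ V V (V →L[ℝ] ℝ)).toContinuousLinearEquiv.toContinuousLinearMap
        (fderiv ℝ G x) + fderiv ℝ G x -
      (ContinuousLinearMap.flipₗᵢ ℝ V V ℝ).toContinuousLinearEquiv.toContinuousLinearMap ∘L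
        (ContinuousLinearMap.flipₗᵢ ℝ V V (V →L[ℝ] ℝ)).toContinuousLinearEquiv.toContinuousLinearMap
          (fderiv ℝ G x)))

theorem christoffel_eq_christoffelCLM (G : V → V →L[ℝ] V →L[ℝ] ℝ) (x v : V) :
    christoffel G x v = christoffelCLM G x v := by
  ext u
  simp only [christoffel, christoffelCLM, ContinuousLinearMap.comp_apply,
    ContinuousLinearMap.compL_apply]
  congr 1

/-- The Sasaki metric contains the Christoffel symbols of `g`, so its own Christoffel symbols
involve their derivative. -/
theorem differentiableAt_christoffelCLM [CompleteSpace V] (hG : ContDiffAt ℝ ∞ G x)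
    (hi : (G x).IsInvertible) : DifferentiableAt ℝ (christoffelCLM G) x := by
  have h1 : DifferentiableAt ℝ (fun y ↦ (G y).inverse) x := by
    obtain ⟨e, he⟩ := hi
    have h := contDiffAt_map_inverse (𝕜 := ℝ) (n := 1) e
    rw [he] at h
    exact (h.differentiableAt one_ne_zero).comp x (hG.differentiableAt (by simp))
  have h2 : DifferentiableAt ℝ (fderiv ℝ G) x :=
    (hG.fderiv_right (m := 1) (by norm_cast)).differentiableAt one_ne_zero
  have h3 : DifferentiableAt ℝ (fun y ↦ (ContinuousLinearMap.flipₗᵢ ℝ V V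
      (V →L[ℝ] ℝ)).toContinuousLinearEquiv.toContinuousLinearMap (fderiv ℝ G y)) x :=
    (ContinuousLinearMap.flipₗᵢ ℝ V V
      (V →L[ℝ] ℝ)).toContinuousLinearEquiv.toContinuousLinearMap.differentiableAt.comp x h2
  refine DifferentiableAt.clm_comp
    ((ContinuousLinearMap.compL ℝ V (V →L[ℝ] ℝ) V).differentiableAt.comp x h1)
    (((h3.fun_add h2).fun_sub ((differentiableAt_const _).clm_comp h3)).fun_const_smul _)

end Christoffel

/-! ### The Sasaki metric along a map into the tangent bundle, in coordinates -/

section CoordinateSasaki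

variable {E : Type*} [NormedAddCommGroup E] [NormedSpace ℝ E]
  {V : Type*} [NormedAddCommGroup V] [NormedSpace ℝ V]

/-- The covariant derivative of the vector field `a` along the map `x`. -/
def covDerivAlong (G : E → E →L[ℝ] E →L[ℝ] ℝ) (x a : V → E) (w : V) : V →L[ℝ] E :=
  fderiv ℝ a w + christoffel G (x w) (a w) ∘L fderiv ℝ x w

/-- The pull-back of the bilinear form `B` along the linear map `A`. -/
def pullbackBilin (B : E →L[ℝ] E →L[ℝ] ℝ) (A : V →L[ℝ] E) : V →L[ℝ] V →L[ℝ] ℝ :=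
  A.precomp ℝ ∘L B ∘L A

@[simp]
theorem pullbackBilin_apply (B : E →L[ℝ] E →L[ℝ] ℝ) (A : V →L[ℝ] E) (u v : V) :
    pullbackBilin B A u v = B (A u) (A v) := rfl

/-- The pull-back of the Sasaki metric along the map `(x, a)` into the tangent bundle. -/
def sasakiAlong (G : E → E →L[ℝ] E →L[ℝ] ℝ) (x a : V → E) (w : V) : V →L[ℝ] V →L[ℝ] ℝ :=
  pullbackBilin (G (x w)) (fderiv ℝ x w) + pullbackBilin (G (x w)) (covDerivAlong G x a w)

theorem fderiv_pullbackBilin {B : V → E →L[ℝ] E →L[ℝ] ℝ} {A : V → V →L[ℝ] E} {w : V}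
    (hB : DifferentiableAt ℝ B w) (hA : DifferentiableAt ℝ A w) :
    DifferentiableAt ℝ (fun y ↦ pullbackBilin (B y) (A y)) w ∧ ∀ d u v,
      fderiv ℝ (fun y ↦ pullbackBilin (B y) (A y)) w d u v =
        fderiv ℝ B w d (A w u) (A w v) + B w (fderiv ℝ A w d u) (A w v) +
          B w (A w u) (fderiv ℝ A w d v) := by
  have h1 : DifferentiableAt ℝ (fun y ↦ ContinuousLinearMap.precomp ℝ (A y)) w :=
    ((ContinuousLinearMap.compL ℝ V E ℝ).flip.differentiableAt).comp w hA
  have h : DifferentiableAt ℝ (fun y ↦ pullbackBilin (B y) (A y)) w :=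
    h1.clm_comp (hB.clm_comp hA)
  refine ⟨h, fun d u v ↦ ?_⟩
  have h2 : HasFDerivAt (fun y ↦ pullbackBilin (B y) (A y) u v) _ w :=
    (h.hasFDerivAt.clm_apply (hasFDerivAt_const u w)).clm_apply (hasFDerivAt_const v w)
  have h3 : HasFDerivAt (fun y ↦ B y (A y u) (A y v)) _ w :=
    (hB.hasFDerivAt.clm_apply (hA.hasFDerivAt.clm_apply (hasFDerivAt_const u w))).clm_apply
      (hA.hasFDerivAt.clm_apply (hasFDerivAt_const v w))
  have h4 := DFunLike.congr_fun (h2.unique h3) d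
  simp at h4
  linarith

/-- Data in coordinates: a metric `G`, a timelike vector field `k`, and an immersion `(x, a)` of `V`
into the associated null congruence, of full dimension. -/
structure IsNullImmersion (G : E → E →L[ℝ] E →L[ℝ] ℝ) (k : E → E) (x a : V → E) (w : V) :
    Prop where
  contDiffAt_metric : ContDiffAt ℝ ∞ G (x w)
  symm : ∀ᶠ y in 𝓝 (x w), ∀ u v, G y u v = G y v u
  lorentzian : IsLorentzianForm (G (x w))
  contDiffAt_field : ContDiffAt ℝ ∞ k (x w)
  timelike : G (x w) (k (x w)) (k (x w)) < 0
  contDiffAt_base : ContDiffAt ℝ ∞ x w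
  contDiffAt_fibre : ContDiffAt ℝ ∞ a w
  null : ∀ᶠ y in 𝓝 w, G (x y) (a y) (a y) = 0
  normalized : ∀ᶠ y in 𝓝 w, G (x y) (a y) (k (x y)) = -1
  immersion : ∀ u, fderiv ℝ x w u = 0 → fderiv ℝ a w u = 0 → u = 0
  finrank_eq : Module.finrank ℝ V + 2 = 2 * Module.finrank ℝ E

namespace IsNullImmersion

variable {G : E → E →L[ℝ] E →L[ℝ] ℝ} {k : E → E} {x a : V → E} {w : V}

theorem covDerivAlong_of_vertical {u : V} (hu : fderiv ℝ x w u = 0) :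
    covDerivAlong G x a w u = fderiv ℝ a w u := by
  simp [covDerivAlong, hu]

/-- Compatibility of the covariant derivative along a map with the metric. -/
theorem fderiv_metric_comp {x : V → E} {b c : V → E} {w : V} (hG : DifferentiableAt ℝ G (x w))
    (hi : (G (x w)).IsInvertible) (hs : ∀ᶠ y in 𝓝 (x w), ∀ u v, G y u v = G y v u)
    (hx : DifferentiableAt ℝ x w) (hb : DifferentiableAt ℝ b w) (hc : DifferentiableAt ℝ c w)
    (u : V) :
    fderiv ℝ (fun y ↦ G (x y) (b y) (c y)) w u =
      G (x w) (covDerivAlong G x b w u) (c w) + G (x w) (b w) (covDerivAlong G x c w u) := by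
  have h : HasFDerivAt (fun y ↦ G (x y) (b y) (c y)) _ w :=
    ((hG.hasFDerivAt.comp w hx.hasFDerivAt).clm_apply hb.hasFDerivAt).clm_apply hc.hasFDerivAt
  rw [h.fderiv]
  simp [covDerivAlong, fderiv_form_eq_christoffel hG hi hs]
  ring

variable (H : IsNullImmersion G k x a w)
include H

theorem differentiableAt_metric : DifferentiableAt ℝ G (x w) :=
  H.contDiffAt_metric.differentiableAt (by simp)

theorem null_self : G (x w) (a w) (a w) = 0 := H.null.self_of_nhds

theorem normalized_self : G (x w) (a w) (k (x w)) = -1 := H.normalized.self_of_nhds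

theorem sasakiAlong_symm (u v : V) : sasakiAlong G x a w u v = sasakiAlong G x a w v u := by
  simp [sasakiAlong, H.lorentzian.symm]

theorem differentiableAt_fderiv_base : DifferentiableAt ℝ (fderiv ℝ x) w :=
  (H.contDiffAt_base.fderiv_right (m := 1) (by norm_cast)).differentiableAt one_ne_zero

theorem differentiableAt_fderiv_fibre : DifferentiableAt ℝ (fderiv ℝ a) w :=
  (H.contDiffAt_fibre.fderiv_right (m := 1) (by norm_cast)).differentiableAt one_ne_zero

variable [FiniteDimensional ℝ E]

theorem null_covDerivAlong (u : V) : G (x w) (a w) (covDerivAlong G x a w u) = 0 := by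
  have h := fderiv_metric_comp H.differentiableAt_metric H.lorentzian.isInvertible H.symm
    (H.contDiffAt_base.differentiableAt (by simp)) (H.contDiffAt_fibre.differentiableAt (by simp))
    (H.contDiffAt_fibre.differentiableAt (by simp)) u
  have h0 : (fun y ↦ G (x y) (a y) (a y)) =ᶠ[𝓝 w] fun _ ↦ (0 : ℝ) := H.null
  rw [h0.fderiv_eq, H.lorentzian.symm (covDerivAlong G x a w u)] at h
  simp at h
  linarith

/-- Differentiate `g(a, K) = -1`; the derivative of `K` along the base map is `∇K` by the chain
rule. This is how `∇K` enters the geometry of the congruence. -/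
theorem field_covDerivAlong (u : V) : G (x w) (covDerivAlong G x a w u) (k (x w)) =
    -G (x w) (a w) (covDeriv G k (x w) (fderiv ℝ x w u)) := by
  have hx := H.contDiffAt_base.differentiableAt (by simp)
  have hk := H.contDiffAt_field.differentiableAt (by simp)
  have h := fderiv_metric_comp H.differentiableAt_metric H.lorentzian.isInvertible H.symm
    hx (H.contDiffAt_fibre.differentiableAt (by simp)) (c := fun y ↦ k (x y)) (hk.comp w hx) u
  have h0 : (fun y ↦ G (x y) (a y) (k (x y))) =ᶠ[𝓝 w] fun _ ↦ (-1 : ℝ) := H.normalized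
  have h1 : covDerivAlong G x (fun y ↦ k (x y)) w u = covDeriv G k (x w) (fderiv ℝ x w u) := by
    simp only [covDerivAlong, covDeriv]
    have h2 : HasFDerivAt (fun y ↦ k (x y)) (fderiv ℝ k (x w) ∘L fderiv ℝ x w) w :=
      hk.hasFDerivAt.comp w hx.hasFDerivAt
    rw [h2.fderiv]
    simp
  rw [h0.fderiv_eq, h1] at h
  simp at h
  linarith

/-- The tangent space of the null congruence, described by the linearized constraints. -/
theorem exists_tangent (d b : E) (h1 : G (x w) (a w) b = 0)
    (h2 : G (x w) b (k (x w)) = -G (x w) (a w) (covDeriv G k (x w) d)) :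
    ∃ u, fderiv ℝ x w u = d ∧ covDerivAlong G x a w u = b := by
  -- `L` maps injectively into the kernel of the constraints `Λ`. Both its range and this kernel
  -- have dimension `2 dim E - 2`, so they coincide.
  let L : V →ₗ[ℝ] E × E := ((fderiv ℝ x w).prod (covDerivAlong G x a w) : V →L[ℝ] E × E)
  let Λ : E × E →ₗ[ℝ] ℝ × ℝ := LinearMap.prod
    ((G (x w) (a w) : E →ₗ[ℝ] ℝ) ∘ₗ LinearMap.snd ℝ E E)
    (((G (x w)).flip (k (x w)) : E →ₗ[ℝ] ℝ) ∘ₗ LinearMap.snd ℝ E E +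
      ((G (x w) (a w) ∘L covDeriv G k (x w) : E →L[ℝ] ℝ) : E →ₗ[ℝ] ℝ) ∘ₗ LinearMap.fst ℝ E E)
  have hL : Function.Injective L := by
    refine (injective_iff_map_eq_zero L).2 fun u hu ↦ ?_
    have h1 : fderiv ℝ x w u = 0 := congrArg Prod.fst hu
    have h2 : covDerivAlong G x a w u = 0 := congrArg Prod.snd hu
    exact H.immersion u h1 (by rw [← h2, covDerivAlong_of_vertical h1])
  have hΛ : Function.Surjective Λ := fun ⟨r, s⟩ ↦ by
    -- Solves for the coefficients of `a` and `k`, using `g(a, a) = 0` and `g(a, k) = -1`.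
    refine ⟨(0, -(s + r * G (x w) (k (x w)) (k (x w))) • a w - r • k (x w)), ?_⟩
    ext <;> simp [Λ, H.null_self, H.normalized_self]
  have hle : LinearMap.range L ≤ LinearMap.ker Λ := by
    rintro _ ⟨u, rfl⟩
    simp [L, Λ, H.null_covDerivAlong, H.field_covDerivAlong]
  have hfin : Module.finrank ℝ (LinearMap.range L) = Module.finrank ℝ (LinearMap.ker Λ) := by
    have e1 := LinearMap.finrank_range_of_inj hL
    have e2 := LinearMap.finrank_range_add_finrank_ker Λ
    rw [LinearMap.range_eq_top.2 hΛ, finrank_top] at e2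
    simp at e2
    have := H.finrank_eq
    omega
  have hmem : (d, b) ∈ LinearMap.ker Λ := by simp [Λ, h1, h2]
  rw [← Submodule.eq_of_le_of_finrank_eq hle hfin] at hmem
  obtain ⟨u, hu⟩ := hmem
  exact ⟨u, congrArg Prod.fst hu, congrArg Prod.snd hu⟩

/-- Horizontal vectors are determined by their base component. -/
theorem covDerivAlong_of_horizontal {z : V}
    (hz : ∀ u, fderiv ℝ x w u = 0 → sasakiAlong G x a w u z = 0) :
    covDerivAlong G x a w z = G (x w) (a w) (covDeriv G k (x w) (fderiv ℝ x w z)) • a w := by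
  set l := G (x w) (a w) (covDeriv G k (x w) (fderiv ℝ x w z)) with hl
  rw [← sub_eq_zero]
  set b := covDerivAlong G x a w z - l • a w with hb
  have hS := H.lorentzian.symm
  have hba : G (x w) (a w) b = 0 := by simp [hb, H.null_covDerivAlong, H.null_self]
  have hbk : G (x w) b (k (x w)) = 0 := by
    simp [hb, H.field_covDerivAlong, H.normalized_self, hl]
  -- The deviation `b` satisfies the vertical constraints, so it comes from a vertical `u`. Pairing
  -- `z` with this `u` yields `g(b, b) = 0`, impossible for nonzero `b` orthogonal to the timelike
  -- `k`.
  obtain ⟨u, hu, hub⟩ := H.exists_tangent 0 b hba (by simp [hbk])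
  have h0 := hz u hu
  simp [sasakiAlong, hu, hub] at h0
  by_contra hne
  have hpos := H.lorentzian.pos_of_orthogonal H.timelike (by rw [hS, hbk]) hne
  have : G (x w) b b = G (x w) b (covDerivAlong G x a w z) - l * G (x w) (a w) b := by
    rw [hS (a w) b]
    conv_lhs => rw [hb, map_sub, map_smul, ← hb]
    simp
  rw [h0, hba] at this
  simp at this
  exact hpos.ne' this

/-- A vector in the kernel is horizontal, and horizontal vectors pair like their projections, since
their connection parts are multiples of the null vector `a`. So its projection vanishes, and then
its connection part does too. This validates the Koszul formula for the induced metric. -/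
theorem isInvertible_sasakiAlong [FiniteDimensional ℝ V] : (sasakiAlong G x a w).IsInvertible := by
  refine isInvertible_of_nondegenerate fun z hz ↦ ?_
  have hC := H.covDerivAlong_of_horizontal (z := z) fun u _ ↦ by rw [H.sasakiAlong_symm, hz]
  have hD : fderiv ℝ x w z = 0 := by
    refine H.lorentzian.eq_zero_of_forall fun d ↦ ?_
    obtain ⟨v, hv, hv'⟩ := H.exists_tangent d
      (G (x w) (a w) (covDeriv G k (x w) d) • a w) (by simp [H.null_self])
      (by simp [H.normalized_self])
    have h := hz v
    simp [sasakiAlong, hC, hv, hv', H.null_self] at h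
    exact h
  rw [hD] at hC
  simp only [map_zero, zero_smul] at hC
  exact H.immersion z hD (by rw [← covDerivAlong_of_vertical hD, hC])

theorem differentiableAt_covDerivAlong : DifferentiableAt ℝ (covDerivAlong G x a) w := by
  unfold covDerivAlong
  simp only [christoffel_eq_christoffelCLM]
  have h1 : DifferentiableAt ℝ (fun y ↦ christoffelCLM G (x y)) w :=
    (differentiableAt_christoffelCLM H.contDiffAt_metric H.lorentzian.isInvertible).comp w
      (H.contDiffAt_base.differentiableAt (by simp))
  exact H.differentiableAt_fderiv_fibre.fun_add
    ((h1.clm_apply (H.contDiffAt_fibre.differentiableAt (by simp))).clm_comp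
      H.differentiableAt_fderiv_base)

/-- The vertical part of the curvature of the connection map vanishes up to a Christoffel term. -/
theorem fderiv_covDerivAlong_sub {u : V} (hu : fderiv ℝ x w u = 0) (z : V) :
    fderiv ℝ (covDerivAlong G x a) w u z - fderiv ℝ (covDerivAlong G x a) w z u =
      christoffel G (x w) (fderiv ℝ a w u) (fderiv ℝ x w z) := by
  have h1 := ((differentiableAt_christoffelCLM H.contDiffAt_metric
    H.lorentzian.isInvertible).hasFDerivAt.comp w
      (H.contDiffAt_base.differentiableAt (by simp)).hasFDerivAt)
  have h2 := H.differentiableAt_fderiv_fibre.hasFDerivAt.add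
    ((h1.clm_apply (H.contDiffAt_fibre.differentiableAt (by simp)).hasFDerivAt).clm_comp
      H.differentiableAt_fderiv_base.hasFDerivAt)
  have h3 : covDerivAlong G x a = fderiv ℝ a + fun y ↦
      ((christoffelCLM G ∘ x) y) (a y) ∘L fderiv ℝ x y := by
    ext y u
    simp [covDerivAlong, christoffel_eq_christoffelCLM]
  have hn : minSmoothness ℝ 2 ≤ (∞ : WithTop ℕ∞) := by simp; norm_cast
  have sx := (H.contDiffAt_base.isSymmSndFDerivAt hn).eq u z
  have sa := (H.contDiffAt_fibre.isSymmSndFDerivAt hn).eq u z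
  -- Second derivatives of `x` and `a` cancel by symmetry; every other term except the asserted one
  -- carries the factor `∂_u x = 0`.
  rw [h3, h2.fderiv, christoffel_eq_christoffelCLM]
  simp [hu, sx, sa]

/-- The second fundamental form of the fibres of the null congruence. -/
theorem sasakiAlong_covDeriv [FiniteDimensional ℝ V] {U : V → V} (hU : DifferentiableAt ℝ U w)
    (hUv : ∀ᶠ y in 𝓝 w, fderiv ℝ x y (U y) = 0) {u z : V} (hu : fderiv ℝ x w u = 0)
    (hz : ∀ u, fderiv ℝ x w u = 0 → sasakiAlong G x a w u z = 0) :
    sasakiAlong G x a w (covDeriv (sasakiAlong G x a) U w u) z =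
      -(G (x w) (fderiv ℝ a w u) (fderiv ℝ a w (U w)) *
        G (x w) (a w) (covDeriv G k (x w) (fderiv ℝ x w z))) := by
  have hC := H.covDerivAlong_of_horizontal hz
  have hU0 := hUv.self_of_nhds
  have hx := H.contDiffAt_base.differentiableAt (by simp)
  have hg : DifferentiableAt ℝ (fun y ↦ G (x y)) w := H.differentiableAt_metric.comp w hx
  have hgf : fderiv ℝ (fun y ↦ G (x y)) w = fderiv ℝ G (x w) ∘L fderiv ℝ x w :=
    (H.differentiableAt_metric.hasFDerivAt.comp w hx.hasFDerivAt).fderiv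
  obtain ⟨hd1, hf1⟩ := fderiv_pullbackBilin hg H.differentiableAt_fderiv_base
  obtain ⟨hd2, hf2⟩ := fderiv_pullbackBilin hg H.differentiableAt_covDerivAlong
  have hf : ∀ d v v', fderiv ℝ (sasakiAlong G x a) w d v v' = _ + _ := fun d v v' ↦ by
    rw [show sasakiAlong G x a = (fun y ↦ pullbackBilin (G (x y)) (fderiv ℝ x y)) +
      fun y ↦ pullbackBilin (G (x y)) (covDerivAlong G x a y) from rfl, fderiv_add hd1 hd2]
    simp only [add_apply]
    rw [hf1, hf2]
  have hn : minSmoothness ℝ 2 ≤ (∞ : WithTop ℕ∞) := by simp; norm_cast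
  have sx := fun d d' ↦ (H.contDiffAt_base.isSymmSndFDerivAt hn).eq d d'
  have hDU : fderiv ℝ (fderiv ℝ x) w u (U w) + fderiv ℝ x w (fderiv ℝ U w u) = 0 := by
    have h1 : HasFDerivAt (fun y ↦ fderiv ℝ x y (U y)) _ w :=
      H.differentiableAt_fderiv_base.hasFDerivAt.clm_apply hU.hasFDerivAt
    have h0 : (fun y ↦ fderiv ℝ x y (U y)) =ᶠ[𝓝 w] fun _ ↦ (0 : E) := hUv
    have h2 := DFunLike.congr_fun (h1.unique ((hasFDerivAt_const (0 : E) w).congr_of_eventuallyEq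
      h0)) u
    simpa [add_comm] using h2
  -- The derivative along `u` of `g(a, c U) = 0`. Since `U` is vertical near `w`, `c U` is `∂_U a`
  -- there, and the identity follows by differentiating `g(a, a) = 0` along `U`.
  have hab : G (x w) (a w) (fderiv ℝ (covDerivAlong G x a) w u (U w) +
      covDerivAlong G x a w (fderiv ℝ U w u)) =
      -G (x w) (fderiv ℝ a w u) (fderiv ℝ a w (U w)) := by
    set c : V → E := fun y ↦ covDerivAlong G x a y (U y) with hc
    have hcd : HasFDerivAt c _ w :=
      H.differentiableAt_covDerivAlong.hasFDerivAt.clm_apply hU.hasFDerivAt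
    have h1 := fderiv_metric_comp H.differentiableAt_metric H.lorentzian.isInvertible H.symm
      hx (H.contDiffAt_fibre.differentiableAt (by simp)) hcd.differentiableAt u
    have h0 : (fun y ↦ G (x y) (a y) (c y)) =ᶠ[𝓝 w] fun _ ↦ (0 : ℝ) := by
      filter_upwards [H.null.eventually_nhds, hUv, hx.continuousAt.eventually H.symm,
        (H.contDiffAt_base.of_le (m := 1) (by norm_cast)).eventually (by simp),
        (H.contDiffAt_fibre.of_le (m := 1) (by norm_cast)).eventually (by simp),
        hx.continuousAt.eventually
          ((H.contDiffAt_metric.of_le (m := 1) (by norm_cast)).eventually (by simp))]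
        with y hy1 hy2 hy3 hy4 hy5 hy6
      have hy0 : (fun y ↦ G (x y) (a y) (a y)) =ᶠ[𝓝 y] fun _ ↦ (0 : ℝ) := hy1
      have hay := (hy5.differentiableAt one_ne_zero).hasFDerivAt
      have hy7 : HasFDerivAt (fun y ↦ G (x y) (a y) (a y)) _ y :=
        (((hy6.differentiableAt one_ne_zero).hasFDerivAt.comp y
          (hy4.differentiableAt one_ne_zero).hasFDerivAt).clm_apply hay).clm_apply hay
      have hy8 := DFunLike.congr_fun
        (hy7.unique ((hasFDerivAt_const (0 : ℝ) y).congr_of_eventuallyEq hy0)) (U y)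
      simp [hy2, hy3 _ (a y)] at hy8
      simp only [hc, covDerivAlong_of_vertical hy2]
      linarith
    have h2 : covDerivAlong G x c w u = fderiv ℝ (covDerivAlong G x a) w u (U w) +
        covDerivAlong G x a w (fderiv ℝ U w u) := by
      simp [covDerivAlong_of_vertical hu, hcd.fderiv, add_comm]
    rw [h0.fderiv_eq, h2, covDerivAlong_of_vertical hu] at h1
    simp only [hc, covDerivAlong_of_vertical hU0] at h1
    simp at h1 ⊢
    linarith
  -- Koszul formula for the induced metric. The base part drops out by `hDU`. In the connection
  -- part, exchanging `z` with a vertical direction costs only Christoffel terms (`c1`, `c2`), which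
  -- cancel the derivative of `g` along `z` by metric compatibility.
  have hkos : sasakiAlong G x a w (covDeriv (sasakiAlong G x a) U w u) z =
      G (x w) (fderiv ℝ (covDerivAlong G x a) w u (U w) +
        covDerivAlong G x a w (fderiv ℝ U w u)) (covDerivAlong G x a w z) := by
    have hCu := covDerivAlong_of_vertical (G := G) (a := a) hu
    have hCU := covDerivAlong_of_vertical (G := G) (a := a) hU0
    have c1 := H.fderiv_covDerivAlong_sub hu z
    have c2 := H.fderiv_covDerivAlong_sub hU0 z
    have c3 := H.fderiv_covDerivAlong_sub hu (U w)
    have hcompat := fderiv_form_eq_christoffel H.differentiableAt_metric H.lorentzian.isInvertible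
      H.symm (fderiv ℝ x w z) (fderiv ℝ a w (U w)) (fderiv ℝ a w u)
    rw [← c1, ← c2] at hcompat
    rw [hU0, map_zero, sub_eq_zero] at c3
    simp only [covDeriv, add_apply, map_add]
    rw [christoffel_apply H.isInvertible_sasakiAlong, hf, hf, hf, hgf]
    simp only [sasakiAlong, add_apply, pullbackBilin_apply,
      ContinuousLinearMap.comp_apply, hu, hU0, map_zero, zero_apply, hCu, hCU,
      hcompat, ← c3, sx (U w) u, eq_neg_of_add_eq_zero_right hDU, map_sub, map_neg,
      sub_apply, neg_apply]
    rw [H.lorentzian.symm (fderiv ℝ a w u) (fderiv ℝ (covDerivAlong G x a) w (U w) z)]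
    ring
  rw [hkos, hC, map_smul, H.lorentzian.symm _ (a w), hab]
  simp
  ring

end IsNullImmersion

end CoordinateSasaki

/-! ### Transformation law of the Christoffel symbols -/

section Transformation

variable {E : Type*} [NormedAddCommGroup E] [NormedSpace ℝ E]
  {V : Type*} [NormedAddCommGroup V] [NormedSpace ℝ V]
  {G G' : E → E →L[ℝ] E →L[ℝ] ℝ} {f : E → E} {x : E}

/-- The transformation law of the Christoffel symbols under a change of coordinates. -/
theorem christoffel_pullback (hG' : DifferentiableAt ℝ G' (f x)) (hi : (G x).IsInvertible)
    (hi' : (G' (f x)).IsInvertible) (hs : ∀ u v, G' (f x) u v = G' (f x) v u)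
    (hf : ContDiffAt ℝ ∞ f x) (hsurj : Function.Surjective (fderiv ℝ f x))
    (hGf : ∀ᶠ y in 𝓝 x, G y = pullbackBilin (G' (f y)) (fderiv ℝ f y)) (v u : E) :
    christoffel G' (f x) (fderiv ℝ f x v) (fderiv ℝ f x u) =
      fderiv ℝ f x (christoffel G x v u) - fderiv ℝ (fderiv ℝ f) x u v := by
  have hfd := hf.differentiableAt (by simp)
  have hf2 : DifferentiableAt ℝ (fderiv ℝ f) x :=
    (hf.fderiv_right (m := 1) (by norm_cast)).differentiableAt one_ne_zero
  have hc : DifferentiableAt ℝ (fun y ↦ G' (f y)) x := hG'.comp x hfd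
  have hcf : fderiv ℝ (fun y ↦ G' (f y)) x = fderiv ℝ G' (f x) ∘L fderiv ℝ f x :=
    (hG'.hasFDerivAt.comp x hfd.hasFDerivAt).fderiv
  obtain ⟨-, hD⟩ := fderiv_pullbackBilin hc hf2
  have hG : ∀ a b, G x a b = G' (f x) (fderiv ℝ f x a) (fderiv ℝ f x b) := fun a b ↦ by
    rw [hGf.self_of_nhds]; rfl
  have hn : minSmoothness ℝ 2 ≤ (∞ : WithTop ℕ∞) := by simp; norm_cast
  have sf := fun d d' ↦ (hf.isSymmSndFDerivAt hn).eq d d'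
  obtain ⟨e, he⟩ := hi'
  -- Both sides are tested against the vectors `∂f b` and expanded by the Koszul formula. Of the six
  -- terms with second derivatives of `f`, four cancel in pairs and the other two agree.
  apply e.injective
  ext b
  obtain ⟨b, rfl⟩ := hsurj b
  have he' : ∀ a, e a = G' (f x) a := fun a ↦ by rw [← he]; rfl
  simp only [he']
  have hGf' : G =ᶠ[𝓝 x] fun y ↦ pullbackBilin (G' (f y)) (fderiv ℝ f y) := hGf
  rw [christoffel_apply ⟨e, he⟩, map_sub, sub_apply, ← hG, christoffel_apply hi,
    hGf'.fderiv_eq, hD, hD, hD, hcf]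
  simp only [ContinuousLinearMap.comp_apply]
  rw [sf b u, sf b v, sf v u, hs _ (fderiv ℝ (fderiv ℝ f) x u b),
    hs _ (fderiv ℝ (fderiv ℝ f) x v b)]
  ring

/-- Invariance of the covariant derivative along a map under a change of coordinates. -/
theorem covDerivAlong_pullback {x a x' a' : V → E} {w : V} (hG' : DifferentiableAt ℝ G' (f (x w)))
    (hi : (G (x w)).IsInvertible) (hi' : (G' (f (x w))).IsInvertible)
    (hs : ∀ u v, G' (f (x w)) u v = G' (f (x w)) v u)
    (hf : ContDiffAt ℝ ∞ f (x w)) (hsurj : Function.Surjective (fderiv ℝ f (x w)))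
    (hGf : ∀ᶠ y in 𝓝 (x w), G y = pullbackBilin (G' (f y)) (fderiv ℝ f y))
    (hx : DifferentiableAt ℝ x w) (ha : DifferentiableAt ℝ a w)
    (hx' : x' =ᶠ[𝓝 w] fun y ↦ f (x y)) (ha' : a' =ᶠ[𝓝 w] fun y ↦ fderiv ℝ f (x y) (a y)) :
    fderiv ℝ x' w = fderiv ℝ f (x w) ∘L fderiv ℝ x w ∧
      covDerivAlong G' x' a' w = fderiv ℝ f (x w) ∘L covDerivAlong G x a w := by
  have h1 : HasFDerivAt (fun y ↦ f (x y)) (fderiv ℝ f (x w) ∘L fderiv ℝ x w) w :=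
    (hf.differentiableAt (by simp)).hasFDerivAt.comp w hx.hasFDerivAt
  have hf2 : DifferentiableAt ℝ (fderiv ℝ f) (x w) :=
    (hf.fderiv_right (m := 1) (by norm_cast)).differentiableAt one_ne_zero
  have h2 : HasFDerivAt (fun y ↦ fderiv ℝ f (x y) (a y)) _ w :=
    (hf2.hasFDerivAt.comp w hx.hasFDerivAt).clm_apply ha.hasFDerivAt
  have h3 : fderiv ℝ x' w = fderiv ℝ f (x w) ∘L fderiv ℝ x w := by rw [hx'.fderiv_eq, h1.fderiv]
  refine ⟨h3, ?_⟩
  ext u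
  simp only [covDerivAlong, h3, add_apply, ContinuousLinearMap.comp_apply]
  rw [hx'.self_of_nhds, ha'.self_of_nhds, ha'.fderiv_eq, h2.fderiv,
    christoffel_pullback hG' hi hi' hs hf hsurj hGf]
  simp

/-- Invariance of the Sasaki metric under a change of coordinates. -/
theorem sasakiAlong_pullback {x a x' a' : V → E} {w : V} (hG' : DifferentiableAt ℝ G' (f (x w)))
    (hi : (G (x w)).IsInvertible) (hi' : (G' (f (x w))).IsInvertible)
    (hs : ∀ u v, G' (f (x w)) u v = G' (f (x w)) v u)
    (hf : ContDiffAt ℝ ∞ f (x w)) (hsurj : Function.Surjective (fderiv ℝ f (x w)))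
    (hGf : ∀ᶠ y in 𝓝 (x w), G y = pullbackBilin (G' (f y)) (fderiv ℝ f y))
    (hx : DifferentiableAt ℝ x w) (ha : DifferentiableAt ℝ a w)
    (hx' : x' =ᶠ[𝓝 w] fun y ↦ f (x y)) (ha' : a' =ᶠ[𝓝 w] fun y ↦ fderiv ℝ f (x y) (a y)) :
    sasakiAlong G' x' a' w = sasakiAlong G x a w := by
  obtain ⟨h1, h2⟩ := covDerivAlong_pullback hG' hi hi' hs hf hsurj hGf hx ha hx' ha'
  ext u v
  simp only [sasakiAlong, h1, h2, hx'.self_of_nhds, hGf.self_of_nhds, add_apply,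
    pullbackBilin_apply, ContinuousLinearMap.comp_apply]

end Transformation

/-! ### The tangent bundle in charts -/

section Charts

variable {n : ℕ} {M : Type*} [TopologicalSpace M] [ChartedSpace (EuclideanSpace ℝ (Fin n)) M]
  [IsManifold (𝓡 n) ∞ M]

theorem components_isInvertible {p x : M} (hx : x ∈ (extChartAt (𝓡 n) p).source) :
    (components (n := n) p x).IsInvertible := isInvertible_mfderiv_extChartAt hx

theorem components_eq_trivializationAt {p : M} (v : TangentBundle (𝓡 n) M)
    (hv : v.proj ∈ (extChartAt (𝓡 n) p).source) : components p v.proj v.snd =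
      (trivializationAt (EuclideanSpace ℝ (Fin n)) (TangentSpace (𝓡 n)) p v).2 := by
  rw [extChartAt_source] at hv
  have h := TangentBundle.continuousLinearMapAt_trivializationAt (I := 𝓡 n) hv
  have h2 := DFunLike.congr_fun h v.snd
  refine h2.symm.trans ?_
  rw [Trivialization.continuousLinearMapAt_apply, Trivialization.linearMapAt_apply, if_pos]
  simpa using hv

omit [IsManifold (𝓡 n) ∞ M] in
theorem mfderiv_extChartAt_symm_eq {p : M} (y : EuclideanSpace ℝ (Fin n)) :
    mfderiv 𝓘(ℝ, EuclideanSpace ℝ (Fin n)) (𝓡 n) (extChartAt (𝓡 n) p).symm y =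
      mfderivWithin 𝓘(ℝ, EuclideanSpace ℝ (Fin n)) (𝓡 n) (extChartAt (𝓡 n) p).symm
        (Set.range (𝓡 n)) y := by
  rw [ModelWithCorners.range_eq_univ, mfderivWithin_univ]

theorem components_mfderiv_symm {p : M} {y : EuclideanSpace ℝ (Fin n)}
    (hy : y ∈ (extChartAt (𝓡 n) p).target) (a : EuclideanSpace ℝ (Fin n)) :
    components p ((extChartAt (𝓡 n) p).symm y)
      (mfderiv 𝓘(ℝ, EuclideanSpace ℝ (Fin n)) (𝓡 n) (extChartAt (𝓡 n) p).symm y a) = a := by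
  rw [mfderiv_extChartAt_symm_eq]
  exact DFunLike.congr_fun (mfderiv_extChartAt_comp_mfderivWithin_extChartAt_symm hy) a

theorem mfderiv_symm_components {p : M} {y : EuclideanSpace ℝ (Fin n)}
    (hy : y ∈ (extChartAt (𝓡 n) p).target)
    (a : TangentSpace (𝓡 n) ((extChartAt (𝓡 n) p).symm y)) :
    mfderiv 𝓘(ℝ, EuclideanSpace ℝ (Fin n)) (𝓡 n) (extChartAt (𝓡 n) p).symm y
      (components p ((extChartAt (𝓡 n) p).symm y) a) = a := by
  rw [mfderiv_extChartAt_symm_eq]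
  exact DFunLike.congr_fun (mfderivWithin_extChartAt_symm_comp_mfderiv_extChartAt hy) a

variable (g : LorentzianMetric n M)

theorem LorentzianMetric.form_eq_inChart {p x : M} (hx : x ∈ (extChartAt (𝓡 n) p).source)
    (a b : TangentSpace (𝓡 n) x) : g.form x a b =
      g.inChart p (extChartAt (𝓡 n) p x) (components p x a) (components p x b) := by
  -- A free point `q` with an equation lets `rintro rfl` replace transport between tangent spaces at
  -- propositionally equal points.
  have key : ∀ (y : EuclideanSpace ℝ (Fin n)) (_ : y ∈ (extChartAt (𝓡 n) p).target) (q : M)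
      (_ : q = (extChartAt (𝓡 n) p).symm y) (a b : TangentSpace (𝓡 n) q), g.form q a b =
      g.inChart p y (components p q a) (components p q b) := by
    rintro y hy q rfl a b
    conv_lhs => rw [← mfderiv_symm_components hy a, ← mfderiv_symm_components hy b]
    rfl
  exact key _ ((extChartAt (𝓡 n) p).map_source hx) x ((extChartAt (𝓡 n) p).left_inv hx).symm a b

theorem LorentzianMetric.inChart_isLorentzianForm {p x : M}
    (hx : x ∈ (extChartAt (𝓡 n) p).source) :
    IsLorentzianForm (g.inChart p (extChartAt (𝓡 n) p x)) := by
  obtain ⟨e, he⟩ := components_isInvertible hx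
  have h : ∀ a b, g.inChart p (extChartAt (𝓡 n) p x) a b = g.form x (e.symm a) (e.symm b) := by
    intro a b
    rw [g.form_eq_inChart hx, ← he]
    simp
  obtain ⟨t, ht, hpos⟩ := g.signature x
  refine ⟨fun u v ↦ by rw [h, h, g.symm], e t, by rw [h]; simpa using ht, fun u hu hu0 ↦ ?_⟩
  rw [h] at hu ⊢
  exact hpos _ (by simpa using hu) (by simpa using hu0)

/-- The metric in a chart is smooth. -/
theorem LorentzianMetric.contDiffOn_inChart (p : M) :
    ContDiffOn ℝ ∞ (g.inChart p) (extChartAt (𝓡 n) p).target := by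
  refine contDiffOn_clm_apply.2 fun a ↦ contDiffOn_clm_apply.2 fun b y₀ hy ↦ ?_
  have hT : (extChartAt (𝓡 n) p).target ∈ 𝓝 y₀ := (isOpen_extChartAt_target p).mem_nhds hy
  have hsymm : ContMDiffAt 𝓘(ℝ, EuclideanSpace ℝ (Fin n)) (𝓡 n) ∞ (extChartAt (𝓡 n) p).symm y₀ :=
    (contMDiffOn_extChartAt_symm p).contMDiffAt hT
  -- Vector fields with constant components in the chart are smooth sections; the coefficients of
  -- the metric are its values on them.
  have hsec : ∀ a : EuclideanSpace ℝ (Fin n),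
      ContMDiffAt 𝓘(ℝ, EuclideanSpace ℝ (Fin n)) (𝓡 n).tangent ∞
        (fun y ↦ (TotalSpace.mk' (EuclideanSpace ℝ (Fin n)) ((extChartAt (𝓡 n) p).symm y)
          (mfderiv 𝓘(ℝ, EuclideanSpace ℝ (Fin n)) (𝓡 n) (extChartAt (𝓡 n) p).symm y a) :
            TangentBundle (𝓡 n) M)) y₀ := by
    intro a
    rw [Trivialization.contMDiffAt_iff
      (e := trivializationAt (EuclideanSpace ℝ (Fin n)) (TangentSpace (𝓡 n)) p)]
    · refine ⟨hsymm, (contMDiffAt_const (c := a)).congr_of_eventuallyEq ?_⟩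
      filter_upwards [hT] with y hy
      rw [← components_eq_trivializationAt _ ((extChartAt (𝓡 n) p).map_target hy)]
      exact components_mfderiv_symm hy a
    · rw [Trivialization.mem_source]
      simpa using (extChartAt (𝓡 n) p).map_target hy
  have h := (g.contMDiff.contMDiffAt.comp y₀ hsymm).clm_bundle_apply₂ (E₃ := fun _ : M ↦ ℝ)
    (F₃ := ℝ) (hsec a) (hsec b)
  rw [Bundle.contMDiffAt_totalSpace] at h
  exact h.2.contDiffAt.contDiffWithinAt

theorem LorentzianMetric.contDiffAt_inChart {p x : M} (hx : x ∈ (extChartAt (𝓡 n) p).source) :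
    ContDiffAt ℝ ∞ (g.inChart p) (extChartAt (𝓡 n) p x) :=
  (g.contDiffOn_inChart p).contDiffAt
    ((isOpen_extChartAt_target p).mem_nhds ((extChartAt (𝓡 n) p).map_source hx))

theorem LorentzianMetric.eventually_inChart_symm {p x : M}
    (hx : x ∈ (extChartAt (𝓡 n) p).source) :
    ∀ᶠ y in 𝓝 (extChartAt (𝓡 n) p x), ∀ u v, g.inChart p y u v = g.inChart p y v u := by
  filter_upwards [(isOpen_extChartAt_target p).mem_nhds ((extChartAt (𝓡 n) p).map_source hx)]
    with y hy
  rw [← (extChartAt (𝓡 n) p).right_inv hy]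
  exact (g.inChart_isLorentzianForm ((extChartAt (𝓡 n) p).map_target hy)).symm

theorem contDiffAt_transition {p q r : M} (hp : r ∈ (extChartAt (𝓡 n) p).source)
    (hq : r ∈ (extChartAt (𝓡 n) q).source) :
    ContDiffAt ℝ ∞ (extChartAt (𝓡 n) q ∘ (extChartAt (𝓡 n) p).symm) (extChartAt (𝓡 n) p r) := by
  have h1 : ContMDiffAt 𝓘(ℝ, EuclideanSpace ℝ (Fin n)) (𝓡 n) ∞ (extChartAt (𝓡 n) p).symm
      (extChartAt (𝓡 n) p r) := (contMDiffOn_extChartAt_symm p).contMDiffAt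
    ((isOpen_extChartAt_target p).mem_nhds ((extChartAt (𝓡 n) p).map_source hp))
  have h2 : ContMDiffAt (𝓡 n) 𝓘(ℝ, EuclideanSpace ℝ (Fin n)) ∞ (extChartAt (𝓡 n) q)
      ((extChartAt (𝓡 n) p).symm (extChartAt (𝓡 n) p r)) := by
    rw [(extChartAt (𝓡 n) p).left_inv hp]
    exact contMDiffAt_extChartAt' (by rwa [← extChartAt_source (𝓡 n)])
  exact (h2.comp _ h1).contDiffAt

theorem fderiv_transition {p q r : M} (hp : r ∈ (extChartAt (𝓡 n) p).source)
    (hq : r ∈ (extChartAt (𝓡 n) q).source) (a : TangentSpace (𝓡 n) r) :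
    fderiv ℝ (extChartAt (𝓡 n) q ∘ (extChartAt (𝓡 n) p).symm) (extChartAt (𝓡 n) p r)
      (components p r a) = components q r a := by
  have h1 : (extChartAt (𝓡 n) q : M → _) =ᶠ[𝓝 r]
      (extChartAt (𝓡 n) q ∘ (extChartAt (𝓡 n) p).symm) ∘ extChartAt (𝓡 n) p := by
    filter_upwards [(isOpen_extChartAt_source p).mem_nhds hp] with s hs
    simp only [Function.comp_apply, (extChartAt (𝓡 n) p).left_inv hs]
  have h2 : MDifferentiableAt (𝓡 n) 𝓘(ℝ, EuclideanSpace ℝ (Fin n)) (extChartAt (𝓡 n) p) r :=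
    mdifferentiableAt_extChartAt (by rwa [← extChartAt_source (𝓡 n)])
  have h3 : MDifferentiableAt 𝓘(ℝ, EuclideanSpace ℝ (Fin n)) 𝓘(ℝ, EuclideanSpace ℝ (Fin n))
      (extChartAt (𝓡 n) q ∘ (extChartAt (𝓡 n) p).symm) (extChartAt (𝓡 n) p r) :=
    ((contDiffAt_transition hp hq).differentiableAt (by simp)).mdifferentiableAt
  have h4 := h1.mfderiv_eq (I := 𝓡 n) (I' := 𝓘(ℝ, EuclideanSpace ℝ (Fin n)))
  rw [mfderiv_comp r h3 h2, mfderiv_eq_fderiv] at h4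
  exact (DFunLike.congr_fun h4 a).symm

theorem LorentzianMetric.inChart_transition {p q r : M} (hp : r ∈ (extChartAt (𝓡 n) p).source)
    (hq : r ∈ (extChartAt (𝓡 n) q).source) :
    ∀ᶠ y in 𝓝 (extChartAt (𝓡 n) p r), g.inChart p y =
      pullbackBilin (g.inChart q ((extChartAt (𝓡 n) q ∘ (extChartAt (𝓡 n) p).symm) y))
        (fderiv ℝ (extChartAt (𝓡 n) q ∘ (extChartAt (𝓡 n) p).symm) y) := by
  have hc := (continuousOn_extChartAt_symm (I := 𝓡 n) p).continuousAt
    ((isOpen_extChartAt_target p).mem_nhds ((extChartAt (𝓡 n) p).map_source hp))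
  have hq' : (extChartAt (𝓡 n) q).source ∈
      𝓝 ((extChartAt (𝓡 n) p).symm (extChartAt (𝓡 n) p r)) := by
    rw [(extChartAt (𝓡 n) p).left_inv hp]
    exact (isOpen_extChartAt_source q).mem_nhds hq
  filter_upwards [(isOpen_extChartAt_target p).mem_nhds ((extChartAt (𝓡 n) p).map_source hp),
    hc.preimage_mem_nhds hq'] with y hy hyq
  obtain ⟨s, hs, rfl⟩ : ∃ s ∈ (extChartAt (𝓡 n) p).source, extChartAt (𝓡 n) p s = y :=
    ⟨_, (extChartAt (𝓡 n) p).map_target hy, (extChartAt (𝓡 n) p).right_inv hy⟩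
  rw [Set.mem_preimage, (extChartAt (𝓡 n) p).left_inv hs] at hyq
  obtain ⟨e, he⟩ := components_isInvertible hs
  ext u v
  obtain ⟨u, rfl⟩ := e.surjective u
  obtain ⟨v, rfl⟩ := e.surjective v
  have he' : ∀ a, e a = components p s a := fun a ↦ by rw [← he]; rfl
  rw [pullbackBilin_apply, he', he', ← g.form_eq_inChart hs, fderiv_transition hs hyq,
    fderiv_transition hs hyq, Function.comp_apply, (extChartAt (𝓡 n) p).left_inv hs,
    ← g.form_eq_inChart hyq]

end Charts

/-! ### Maps into the tangent bundle in charts -/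

section Along

variable {n : ℕ} {M : Type*} [TopologicalSpace M] [ChartedSpace (EuclideanSpace ℝ (Fin n)) M]
  [IsManifold (𝓡 n) ∞ M] {V : Type*} [NormedAddCommGroup V] [NormedSpace ℝ V]

/-- The base point of a map into the tangent bundle, in the chart around `p`. -/
def baseCoord (p : M) (φ : V → TangentBundle (𝓡 n) M) (y : V) : EuclideanSpace ℝ (Fin n) :=
  extChartAt (𝓡 n) p (φ y).proj

/-- The components of a map into the tangent bundle, in the chart around `p`. -/
def fibreCoord (p : M) (φ : V → TangentBundle (𝓡 n) M) (y : V) : EuclideanSpace ℝ (Fin n) :=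
  components p (φ y).proj (φ y).snd

variable {p : M} {φ : V → TangentBundle (𝓡 n) M} {w : V}

theorem contMDiffAt_tangentBundle_iff (hp : (φ w).proj ∈ (extChartAt (𝓡 n) p).source) :
    ContMDiffAt 𝓘(ℝ, V) (𝓡 n).tangent ∞ φ w ↔
      ContMDiffAt 𝓘(ℝ, V) (𝓡 n) ∞ (fun y ↦ (φ y).proj) w ∧ ContDiffAt ℝ ∞ (fibreCoord p φ) w := by
  rw [Trivialization.contMDiffAt_iff
    (e := trivializationAt (EuclideanSpace ℝ (Fin n)) (TangentSpace (𝓡 n)) p)]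
  · refine and_congr_right fun h ↦ ?_
    rw [contMDiffAt_iff_contDiffAt]
    have he : fibreCoord p φ =ᶠ[𝓝 w] fun y ↦
        (trivializationAt (EuclideanSpace ℝ (Fin n)) (TangentSpace (𝓡 n)) p (φ y)).2 := by
      filter_upwards [h.continuousAt.preimage_mem_nhds
        ((isOpen_extChartAt_source (I := 𝓡 n) p).mem_nhds hp)] with y hy
      exact components_eq_trivializationAt _ hy
    exact ⟨fun h ↦ h.congr_of_eventuallyEq he, fun h ↦ h.congr_of_eventuallyEq he.symm⟩
  · rw [Trivialization.mem_source]
    simpa using hp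

variable (hφ : ContMDiffAt 𝓘(ℝ, V) (𝓡 n).tangent ∞ φ w)
include hφ

theorem continuousAt_proj : ContinuousAt (fun y ↦ (φ y).proj) w :=
  ((contMDiffAt_tangentBundle_iff (mem_extChartAt_source (φ w).proj)).1 hφ).1.continuousAt

theorem eventually_proj_mem (hp : (φ w).proj ∈ (extChartAt (𝓡 n) p).source) :
    ∀ᶠ y in 𝓝 w, (φ y).proj ∈ (extChartAt (𝓡 n) p).source :=
  (continuousAt_proj hφ).preimage_mem_nhds ((isOpen_extChartAt_source (I := 𝓡 n) p).mem_nhds hp)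

theorem contDiffAt_baseCoord (hp : (φ w).proj ∈ (extChartAt (𝓡 n) p).source) :
    ContDiffAt ℝ ∞ (baseCoord p φ) w := by
  have h1 := ((contMDiffAt_tangentBundle_iff hp).1 hφ).1
  have h2 : ContMDiffAt (𝓡 n) 𝓘(ℝ, EuclideanSpace ℝ (Fin n)) ∞ (extChartAt (𝓡 n) p) (φ w).proj :=
    contMDiffAt_extChartAt' (by rwa [← extChartAt_source (𝓡 n)])
  exact (h2.comp w h1).contDiffAt

theorem contDiffAt_fibreCoord (hp : (φ w).proj ∈ (extChartAt (𝓡 n) p).source) :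
    ContDiffAt ℝ ∞ (fibreCoord p φ) w :=
  ((contMDiffAt_tangentBundle_iff hp).1 hφ).2

theorem components_dproj (hp : (φ w).proj ∈ (extChartAt (𝓡 n) p).source) (u : V) :
    components p (φ w).proj (dproj (φ w) (mfderiv 𝓘(ℝ, V) (𝓡 n).tangent φ w u)) =
      fderiv ℝ (baseCoord p φ) w u := by
  have h1 : MDifferentiableAt 𝓘(ℝ, V) (𝓡 n).tangent φ w := hφ.mdifferentiableAt (by simp)
  have h2 : MDifferentiableAt (𝓡 n).tangent (𝓡 n)
      (TotalSpace.proj : TangentBundle (𝓡 n) M → M) (φ w) :=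
    (contMDiffAt_proj (n := 1) (TangentSpace (𝓡 n))).mdifferentiableAt (by simp)
  have h3 : MDifferentiableAt (𝓡 n) 𝓘(ℝ, EuclideanSpace ℝ (Fin n)) (extChartAt (𝓡 n) p)
      (φ w).proj := mdifferentiableAt_extChartAt (by rwa [← extChartAt_source (𝓡 n)])
  have h4 : mfderiv 𝓘(ℝ, V) 𝓘(ℝ, EuclideanSpace ℝ (Fin n))
      (extChartAt (𝓡 n) p ∘ TotalSpace.proj ∘ φ) w = _ :=
    mfderiv_comp w h3 (h2.comp w h1)
  rw [mfderiv_comp w h2 h1, mfderiv_eq_fderiv] at h4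
  exact (DFunLike.congr_fun h4 u).symm

theorem isVertical_iff (hp : (φ w).proj ∈ (extChartAt (𝓡 n) p).source) (u : V) :
    IsVertical φ w u ↔ fderiv ℝ (baseCoord p φ) w u = 0 := by
  rw [← components_dproj hφ hp]
  obtain ⟨e, he⟩ := components_isInvertible hp
  rw [← he]
  exact e.map_eq_zero_iff.symm

theorem mvfderiv_components (hp : (φ w).proj ∈ (extChartAt (𝓡 n) p).source) (u : V) :
    mvfderiv (𝓡 n).tangent (fun v' : TangentBundle (𝓡 n) M ↦ components p v'.proj v'.snd) (φ w)
      (mfderiv 𝓘(ℝ, V) (𝓡 n).tangent φ w u) = fderiv ℝ (fibreCoord p φ) w u := by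
  have h1 : MDifferentiableAt 𝓘(ℝ, V) (𝓡 n).tangent φ w := hφ.mdifferentiableAt (by simp)
  have h2 : MDifferentiableAt (𝓡 n).tangent 𝓘(ℝ, EuclideanSpace ℝ (Fin n))
      (fun v' : TangentBundle (𝓡 n) M ↦ components p v'.proj v'.snd) (φ w) := by
    have h : ContMDiffAt (𝓡 n).tangent (𝓡 n).tangent ∞
        (id : TangentBundle (𝓡 n) M → TangentBundle (𝓡 n) M) (φ w) := contMDiffAt_id
    rw [Trivialization.contMDiffAt_iff (e := trivializationAt (EuclideanSpace ℝ (Fin n))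
      (TangentSpace (𝓡 n)) p) (by rw [Trivialization.mem_source]; simpa using hp)] at h
    refine MDifferentiableAt.congr_of_eventuallyEq (h.2.mdifferentiableAt (by simp)) ?_
    filter_upwards [h.1.continuousAt.preimage_mem_nhds
      ((isOpen_extChartAt_source (I := 𝓡 n) _).mem_nhds hp)] with y hy
    exact components_eq_trivializationAt _ hy
  have h3 : mfderiv 𝓘(ℝ, V) 𝓘(ℝ, EuclideanSpace ℝ (Fin n)) (fibreCoord p φ) w = _ :=
    mfderiv_comp w h2 h1
  rw [mfderiv_eq_fderiv] at h3
  exact (DFunLike.congr_fun h3 u).symm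

/-- A vector is determined by its image in the coordinates of the tangent bundle. -/
theorem mfderiv_eq_zero_of_coord {u : V} (h1 : fderiv ℝ (baseCoord (φ w).proj φ) w u = 0)
    (h2 : fderiv ℝ (fibreCoord (φ w).proj φ) w u = 0) :
    mfderiv 𝓘(ℝ, V) (𝓡 n).tangent φ w u = 0 := by
  have hp := mem_extChartAt_source (I := 𝓡 n) (φ w).proj
  have hΦ := isInvertible_mfderiv_extChartAt (I := (𝓡 n).tangent)
    (mem_extChartAt_source (I := (𝓡 n).tangent) (φ w))
  have h3 : MDifferentiableAt 𝓘(ℝ, V) (𝓡 n).tangent φ w := hφ.mdifferentiableAt (by simp)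
  have h4 := mdifferentiableAt_extChartAt (I := (𝓡 n).tangent)
    (mem_chart_source (ModelProd (EuclideanSpace ℝ (Fin n)) (EuclideanSpace ℝ (Fin n))) (φ w))
  have h5 : (extChartAt (𝓡 n).tangent (φ w)) ∘ φ =ᶠ[𝓝 w]
      fun y ↦ (baseCoord (φ w).proj φ y, fibreCoord (φ w).proj φ y) := by
    filter_upwards [eventually_proj_mem hφ hp] with y hy
    rw [Function.comp_apply, FiberBundle.extChartAt]
    refine Prod.ext ?_ (components_eq_trivializationAt _ hy).symm
    simp [baseCoord]
  have h6 := mfderiv_comp w h4 h3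
  rw [mfderiv_eq_fderiv, h5.fderiv_eq,
    ((contDiffAt_baseCoord hφ hp).differentiableAt (by simp)).fderiv_prodMk
      ((contDiffAt_fibreCoord hφ hp).differentiableAt (by simp))] at h6
  have h7 := DFunLike.congr_fun h6 u
  obtain ⟨e, he⟩ := hΦ
  rw [← he] at h7
  refine e.map_eq_zero_iff.1 (h7.symm.trans ?_)
  exact Prod.ext h1 h2

variable (g : LorentzianMetric n M)

theorem LorentzianMetric.components_connector (u : V) :
    components (φ w).proj (φ w).proj
      (g.connector (φ w) (mfderiv 𝓘(ℝ, V) (𝓡 n).tangent φ w u)) =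
      covDerivAlong (g.inChart (φ w).proj) (baseCoord (φ w).proj φ) (fibreCoord (φ w).proj φ) w
        u := by
  have hp := mem_extChartAt_source (I := 𝓡 n) (φ w).proj
  have h4 : (mvfderiv (𝓡 n).tangent (fun v' : TangentBundle (𝓡 n) M ↦
      components (φ w).proj v'.proj v'.snd) (φ w)) (mfderiv 𝓘(ℝ, V) (𝓡 n).tangent φ w u) =
      fderiv ℝ (fibreCoord (φ w).proj φ) w u := mvfderiv_components hφ hp u
  simp only [LorentzianMetric.connector, ContinuousLinearMap.comp_apply, add_apply]
  rw [(components_isInvertible hp).self_apply_inverse, components_dproj hφ hp, h4]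
  rfl

/-- Only a pointwise identity: the chart on the right moves with `w`, so it cannot be differentiated
as it stands. -/
theorem LorentzianMetric.pullbackForm_sasaki :
    pullbackForm (J := (𝓡 n).tangent) φ g.sasaki w =
      sasakiAlong (g.inChart (φ w).proj) (baseCoord (φ w).proj φ) (fibreCoord (φ w).proj φ) w := by
  have hp := mem_extChartAt_source (I := 𝓡 n) (φ w).proj
  ext u v
  rw [sasakiAlong, add_apply, add_apply, pullbackBilin_apply, pullbackBilin_apply,
    ← components_dproj hφ hp, ← components_dproj hφ hp, ← g.components_connector hφ,
    ← g.components_connector hφ]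
  exact (congrArg₂ (· + ·) (g.form_eq_inChart hp _ _) (g.form_eq_inChart hp _ _))

/-- The pull-back of the Sasaki metric can be computed in any chart. -/
theorem LorentzianMetric.pullbackForm_sasaki_eq
    (hp : (φ w).proj ∈ (extChartAt (𝓡 n) p).source) :
    pullbackForm (J := (𝓡 n).tangent) φ g.sasaki w =
      sasakiAlong (g.inChart p) (baseCoord p φ) (fibreCoord p φ) w := by
  have hq := mem_extChartAt_source (I := 𝓡 n) (φ w).proj
  have hf : (extChartAt (𝓡 n) (φ w).proj ∘ (extChartAt (𝓡 n) p).symm) (baseCoord p φ w) =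
      extChartAt (𝓡 n) (φ w).proj (φ w).proj := by
    simp only [baseCoord, Function.comp_apply, (extChartAt (𝓡 n) p).left_inv hp]
  have hL := g.inChart_isLorentzianForm hq
  rw [g.pullbackForm_sasaki hφ]
  refine sasakiAlong_pullback
    (f := extChartAt (𝓡 n) (φ w).proj ∘ (extChartAt (𝓡 n) p).symm) ?_
    (g.inChart_isLorentzianForm hp).isInvertible ?_ ?_ (contDiffAt_transition hp hq) ?_
    (g.inChart_transition hp hq) ((contDiffAt_baseCoord hφ hp).differentiableAt (by simp))
    ((contDiffAt_fibreCoord hφ hp).differentiableAt (by simp)) ?_ ?_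
  · rw [hf]
    exact (g.contDiffAt_inChart hq).differentiableAt (by simp)
  · rw [hf]
    exact hL.isInvertible
  · rw [hf]
    exact hL.symm
  · intro b
    obtain ⟨e, he⟩ := components_isInvertible hq
    exact ⟨components p (φ w).proj (e.symm b), by
      rw [baseCoord, fderiv_transition hp hq, ← he]; exact e.apply_symm_apply b⟩
  · filter_upwards [eventually_proj_mem hφ hp] with y hy
    simp only [baseCoord, Function.comp_apply, (extChartAt (𝓡 n) p).left_inv hy]
  · filter_upwards [eventually_proj_mem hφ hp, eventually_proj_mem hφ hq] with y hy hyq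
    exact (fderiv_transition hy hyq _).symm

end Along

/-! ### The second fundamental form of the fibres -/

section SecondFundamentalForm

variable {n : ℕ} {M : Type*} [TopologicalSpace M] [ChartedSpace (EuclideanSpace ℝ (Fin n)) M]
  [IsManifold (𝓡 n) ∞ M] (g : LorentzianMetric n M) {K : ∀ p : M, TangentSpace (𝓡 n) p}

/-- The components of a vector field in the chart around `p`. -/
def fieldInChart (K : ∀ p : M, TangentSpace (𝓡 n) p) (p : M) (y : EuclideanSpace ℝ (Fin n)) :
    EuclideanSpace ℝ (Fin n) :=
  components p ((extChartAt (𝓡 n) p).symm y) (K ((extChartAt (𝓡 n) p).symm y))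

omit [IsManifold (𝓡 n) ∞ M] in
theorem fieldInChart_extChartAt {p x : M} (hx : x ∈ (extChartAt (𝓡 n) p).source) :
    fieldInChart K p (extChartAt (𝓡 n) p x) = components p x (K x) := by
  rw [fieldInChart, (extChartAt (𝓡 n) p).left_inv hx]

theorem contDiffOn_fieldInChart (hK : ContMDiff (𝓡 n) (𝓡 n).tangent ∞
      (fun p ↦ (TotalSpace.mk p (K p) : TangentBundle (𝓡 n) M))) (p : M) :
    ContDiffOn ℝ ∞ (fieldInChart K p) (extChartAt (𝓡 n) p).target := by
  intro y hy
  have hsymm : ContMDiffAt 𝓘(ℝ, EuclideanSpace ℝ (Fin n)) (𝓡 n) ∞ (extChartAt (𝓡 n) p).symm y :=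
    (contMDiffOn_extChartAt_symm p).contMDiffAt ((isOpen_extChartAt_target p).mem_nhds hy)
  exact (contDiffAt_fibreCoord (hK.contMDiffAt.comp y hsymm)
    ((extChartAt (𝓡 n) p).map_target hy)).contDiffWithinAt

theorem LorentzianMetric.isParallel_iff : g.IsParallel K ↔ ∀ (p : M) (d : EuclideanSpace ℝ (Fin n)),
    covDeriv (g.inChart p) (fieldInChart K p) (extChartAt (𝓡 n) p p) d = 0 := by
  refine forall_congr' fun p ↦ ?_
  obtain ⟨e, he⟩ := components_isInvertible (mem_extChartAt_source (I := 𝓡 n) p)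
  have h : ∀ u, g.nabla K p u = e.symm
      (covDeriv (g.inChart p) (fieldInChart K p) (extChartAt (𝓡 n) p p) (e u)) := fun u ↦ by
    simp only [LorentzianMetric.nabla, ContinuousLinearMap.comp_apply]
    rw [← he]
    simp
    rfl
  refine ⟨fun H d ↦ ?_, fun H u ↦ by rw [h, H, map_zero]⟩
  have h1 := H (e.symm d)
  rw [h, e.apply_symm_apply] at h1
  exact e.symm.map_eq_zero_iff.1 h1

variable {g} {W : Set (EuclideanSpace ℝ (Fin (2 * (n - 1))))}
  {φ : EuclideanSpace ℝ (Fin (2 * (n - 1))) → TangentBundle (𝓡 n) M}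

theorem IsLocalParametrization.isNullImmersion (hn : 1 ≤ n)
    (hφ : IsLocalParametrization (𝓡 n).tangent (g.nullCongruence K) W φ)
    (hK : ContMDiff (𝓡 n) (𝓡 n).tangent ∞
      (fun p ↦ (TotalSpace.mk p (K p) : TangentBundle (𝓡 n) M)))
    (hKt : g.IsTimelike K) {w : EuclideanSpace ℝ (Fin (2 * (n - 1)))} (hw : w ∈ W) :
    IsNullImmersion (g.inChart (φ w).proj) (fieldInChart K (φ w).proj)
      (baseCoord (φ w).proj φ) (fibreCoord (φ w).proj φ) w := by
  have hp := mem_extChartAt_source (I := 𝓡 n) (φ w).proj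
  have hWn := hφ.isOpen.mem_nhds hw
  have hφw := hφ.contMDiffOn.contMDiffAt hWn
  refine
    { contDiffAt_metric := g.contDiffAt_inChart hp
      symm := g.eventually_inChart_symm hp
      lorentzian := g.inChart_isLorentzianForm hp
      contDiffAt_field := (contDiffOn_fieldInChart hK _).contDiffAt
        ((isOpen_extChartAt_target _).mem_nhds (mem_extChartAt_target _))
      timelike := ?_
      contDiffAt_base := contDiffAt_baseCoord hφw hp
      contDiffAt_fibre := contDiffAt_fibreCoord hφw hp
      null := ?_
      normalized := ?_
      immersion := ?_
      finrank_eq := by simp; omega }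
  · rw [baseCoord, fieldInChart_extChartAt hp, ← g.form_eq_inChart hp]
    exact hKt _
  · filter_upwards [hWn, eventually_proj_mem hφw hp] with y hy hyp
    rw [baseCoord, fibreCoord, ← g.form_eq_inChart hyp]
    exact (hφ.mapsTo hy).1
  · filter_upwards [hWn, eventually_proj_mem hφw hp] with y hy hyp
    rw [baseCoord, fibreCoord, fieldInChart_extChartAt hyp, ← g.form_eq_inChart hyp]
    exact (hφ.mapsTo hy).2
  · intro u h1 h2
    exact hφ.injective_mfderiv w hw ((mfderiv_eq_zero_of_coord hφw h1 h2).trans (map_zero _).symm)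

/-- The second fundamental form of the fibres of the null congruence. -/
theorem IsLocalParametrization.pullbackForm_covDeriv (hn : 1 ≤ n)
    (hφ : IsLocalParametrization (𝓡 n).tangent (g.nullCongruence K) W φ)
    (hK : ContMDiff (𝓡 n) (𝓡 n).tangent ∞
      (fun p ↦ (TotalSpace.mk p (K p) : TangentBundle (𝓡 n) M)))
    (hKt : g.IsTimelike K)
    {U : EuclideanSpace ℝ (Fin (2 * (n - 1))) → EuclideanSpace ℝ (Fin (2 * (n - 1)))}
    (hU : ContDiffOn ℝ ∞ U W) (hUv : ∀ w ∈ W, IsVertical φ w (U w))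
    {w : EuclideanSpace ℝ (Fin (2 * (n - 1)))} (hw : w ∈ W)
    {u z : EuclideanSpace ℝ (Fin (2 * (n - 1)))} (hu : IsVertical φ w u)
    (hz : g.IsHorizontal φ w z) :
    pullbackForm (J := (𝓡 n).tangent) φ g.sasaki w
      (covDeriv (pullbackForm (J := (𝓡 n).tangent) φ g.sasaki) U w u) z =
      -(g.inChart (φ w).proj (baseCoord (φ w).proj φ w) (fderiv ℝ (fibreCoord (φ w).proj φ) w u)
          (fderiv ℝ (fibreCoord (φ w).proj φ) w (U w)) *
        g.inChart (φ w).proj (baseCoord (φ w).proj φ w) (fibreCoord (φ w).proj φ w)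
          (covDeriv (g.inChart (φ w).proj) (fieldInChart K (φ w).proj) (baseCoord (φ w).proj φ w)
            (fderiv ℝ (baseCoord (φ w).proj φ) w z))) := by
  have hp := mem_extChartAt_source (I := 𝓡 n) (φ w).proj
  have hWn := hφ.isOpen.mem_nhds hw
  have hφw := hφ.contMDiffOn.contMDiffAt hWn
  -- The chart is now frozen at `φ w`, so the identity holds on a neighbourhood and passes to the
  -- Christoffel symbols.
  have hS : pullbackForm (J := (𝓡 n).tangent) φ g.sasaki =ᶠ[𝓝 w]
      sasakiAlong (g.inChart (φ w).proj) (baseCoord (φ w).proj φ) (fibreCoord (φ w).proj φ) := by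
    filter_upwards [hφ.isOpen.mem_nhds hw, eventually_proj_mem hφw hp] with y hy hyp
    exact g.pullbackForm_sasaki_eq (hφ.contMDiffOn.contMDiffAt (hφ.isOpen.mem_nhds hy)) hyp
  have hcov : covDeriv (pullbackForm (J := (𝓡 n).tangent) φ g.sasaki) U w =
      covDeriv (sasakiAlong (g.inChart (φ w).proj) (baseCoord (φ w).proj φ)
        (fibreCoord (φ w).proj φ)) U w := by
    simp only [covDeriv, christoffel, hS.fderiv_eq, hS.self_of_nhds]
  rw [hcov, hS.self_of_nhds]
  refine (hφ.isNullImmersion hn hK hKt hw).sasakiAlong_covDeriv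
    ((hU.contDiffAt hWn).differentiableAt (by simp)) ?_ ((isVertical_iff hφw hp u).1 hu) ?_
  · filter_upwards [hφ.isOpen.mem_nhds hw, eventually_proj_mem hφw hp] with y hy hyp
    exact (isVertical_iff (hφ.contMDiffOn.contMDiffAt (hφ.isOpen.mem_nhds hy)) hyp _).1 (hUv y hy)
  · intro u' hu'
    rw [← hS.self_of_nhds]
    exact hz u' ((isVertical_iff hφw hp u').2 hu')

end SecondFundamentalForm

/-! ### Local parametrizations of the null congruence -/

section InverseFunction

variable {X : Type*} [NormedAddCommGroup X] [NormedSpace ℝ X] [CompleteSpace X]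
  {Y : Type*} [NormedAddCommGroup Y] [NormedSpace ℝ Y]

/-- The inverse function theorem, with a smooth inverse on an open set. -/
theorem exists_openPartialHomeomorph {Ψ : X → Y} {O : Set X} {x₀ : X} (hO : IsOpen O) (hx₀ : x₀ ∈ O)
    (hΨ : ContDiffOn ℝ ∞ Ψ O) (hinv : (fderiv ℝ Ψ x₀).IsInvertible) :
    ∃ e : OpenPartialHomeomorph X Y, x₀ ∈ e.source ∧ e.source ⊆ O ∧ ⇑e = Ψ ∧
      ContDiffOn ℝ ∞ e.symm e.target := by
  have hat : ∀ x ∈ O, ContDiffAt ℝ ∞ Ψ x := fun x hx ↦ hΨ.contDiffAt (hO.mem_nhds hx)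
  obtain ⟨f', hf'⟩ := hinv
  have hf₀ : HasFDerivAt Ψ (f' : X →L[ℝ] Y) x₀ := by
    rw [hf']
    exact ((hat x₀ hx₀).differentiableAt (by simp)).hasFDerivAt
  let e₀ := (hat x₀ hx₀).toOpenPartialHomeomorph Ψ hf₀ (by simp)
  -- Restricting to the open set where the derivative is invertible makes the inverse smooth on the
  -- whole target, not just at the image of `x₀`.
  let O' : Set X := O ∩ fderiv ℝ Ψ ⁻¹' Set.range ((↑) : (X ≃L[ℝ] Y) → X →L[ℝ] Y)
  have hO' : IsOpen O' := (hΨ.continuousOn_fderiv_of_isOpen hO (by simp)).isOpen_inter_preimage hO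
    ContinuousLinearEquiv.isOpen
  refine ⟨e₀.restrOpen O' hO', ⟨(hat x₀ hx₀).mem_toOpenPartialHomeomorph_source hf₀ (by simp),
    hx₀, f', hf'⟩, fun x hx ↦ hx.2.1, rfl, fun y hy ↦ ?_⟩
  obtain ⟨-, hyO, f, hf⟩ := (e₀.restrOpen O' hO').map_target hy
  refine ((e₀.restrOpen O' hO').contDiffAt_symm (f₀' := f) hy ?_ (hat _ hyO)).contDiffWithinAt
  rw [hf]
  exact ((hat _ hyO).differentiableAt (by simp)).hasFDerivAt

end InverseFunction

/-! ### Slices of local homeomorphisms. -/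

section Embedding

variable {N Y V : Type*} [TopologicalSpace N] [TopologicalSpace Y] [TopologicalSpace V]

/-- A slice of a local homeomorphism parametrizes an open subset of the sliced set. -/
theorem isOpenEmbedding_slice (h : OpenPartialHomeomorph N Y) {ι : V → Y}
    (hι : Topology.IsEmbedding ι) {S : Set N}
    (hS : ∀ v ∈ h.source, v ∈ S ↔ h v ∈ Set.range ι)
    (hm : Set.MapsTo (h.symm ∘ ι) (ι ⁻¹' h.target) S) :
    Topology.IsOpenEmbedding (hm.restrict (h.symm ∘ ι) (ι ⁻¹' h.target) S) := by
  have h1 : Topology.IsEmbedding ((ι ⁻¹' h.target).domRestrict (h.symm ∘ ι)) :=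
    h.symm.isOpenEmbedding_restrict.isEmbedding.comp
      (hι.restrictPreimage h.target)
  refine ⟨Topology.IsEmbedding.of_comp ?_ continuous_subtype_val h1, ?_⟩
  · exact (h1.continuous.subtype_mk _)
  · have : Set.range (hm.restrict (h.symm ∘ ι) (ι ⁻¹' h.target) S) =
        Subtype.val ⁻¹' h.source := by
      ext ⟨v, hv⟩
      constructor
      · rintro ⟨⟨w, hw⟩, hwv⟩
        have : h.symm (ι w) = v := congrArg Subtype.val hwv
        exact this ▸ h.map_target hw
      · intro hvs
        obtain ⟨w, hw⟩ := (hS v hvs).1 hv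
        refine ⟨⟨w, ?_⟩, Subtype.ext ?_⟩
        · rw [Set.mem_preimage, hw]
          exact h.map_source hvs
        · change h.symm (ι w) = v
          rw [hw, h.left_inv hvs]
    rw [this]
    exact h.open_source.preimage continuous_subtype_val

end Embedding

/-! ### Null vectors and charts straightening the constraints. -/

section LinearAlgebra

variable {E : Type*} [NormedAddCommGroup E] [NormedSpace ℝ E] [FiniteDimensional ℝ E]
  {B : E →L[ℝ] E →L[ℝ] ℝ} {k : E}

/-- Linear coordinates on the vertical space, the orthogonal complement of `a` and `k`, extended to
`E`. They complete the two constraints to a coordinate system. -/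
theorem exists_projection {a : E} (ha : B a a = 0) (hak : B a k = -1)
    {m : ℕ} (hm : Module.finrank ℝ E = m + 2) :
    ∃ P : E →L[ℝ] EuclideanSpace ℝ (Fin m), ∀ b, B a b = 0 → B b k = 0 → P b = 0 → b = 0 := by
  let Λ : E →ₗ[ℝ] ℝ × ℝ := LinearMap.prod (B a : E →ₗ[ℝ] ℝ) (B.flip k : E →ₗ[ℝ] ℝ)
  have hΛ : Function.Surjective Λ := fun ⟨r, s⟩ ↦ by
    refine ⟨-(s + r * B k k) • a - r • k, ?_⟩
    ext <;> simp [Λ, ha, hak]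
  have hfin : Module.finrank ℝ (LinearMap.ker Λ) = m := by
    have e2 := LinearMap.finrank_range_add_finrank_ker Λ
    rw [LinearMap.range_eq_top.2 hΛ, finrank_top] at e2
    simp at e2
    omega
  let e : LinearMap.ker Λ ≃ₗ[ℝ] EuclideanSpace ℝ (Fin m) :=
    LinearEquiv.ofFinrankEq _ _ (by simp [hfin])
  obtain ⟨P, hP⟩ := LinearMap.exists_extend e.toLinearMap
  refine ⟨LinearMap.toContinuousLinearMap P, fun b h1 h2 h3 ↦ ?_⟩
  have hb : b ∈ LinearMap.ker Λ := by simp [Λ, h1, h2]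
  have h4 : e ⟨b, hb⟩ = 0 := (DFunLike.congr_fun hP ⟨b, hb⟩).symm.trans h3
  simpa using h4

omit [FiniteDimensional ℝ E] in
/-- The normalized null vectors span. -/
theorem IsLorentzianForm.eq_zero_of_null (hB : IsLorentzianForm B) (hk : B k k < 0)
    (hE : 2 ≤ Module.finrank ℝ E) {b : E} (h : ∀ a, B a a = 0 → B a k = -1 → B a b = 0) :
    b = 0 := by
  have key : ∀ s, B k s = 0 → s ≠ 0 → B k b = 0 ∧ B s b = 0 := by
    intro s hs hs0
    have hpos := hB.pos_of_orthogonal hk hs hs0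
    -- Chosen so that `-k / B(k, k) ± r s` is null; the coefficient of `k` gives the normalization
    -- `-1`.
    set r := Real.sqrt (-(B s s * B k k)⁻¹) with hr
    have hmul : B s s * B k k < 0 := mul_neg_of_pos_of_neg hpos hk
    have hr2 : r * r = -(B s s * B k k)⁻¹ :=
      Real.mul_self_sqrt (neg_nonneg.2 (inv_nonpos.2 hmul.le))
    have hr0 : r ≠ 0 := by
      intro h0
      rw [h0] at hr2
      have := inv_ne_zero hmul.ne
      apply this
      linarith
    have hsk : B s k = 0 := by rw [hB.symm, hs]
    have hnull : ∀ t : ℝ, t * t = r * r → -(B k k)⁻¹ * B k b + t * B s b = 0 := by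
      intro t ht
      have h1 := h (-(B k k)⁻¹ • k + t • s) (by
        simp [hs, hsk]
        have : t * (t * B s s) = -(B k k)⁻¹ := by
          rw [← mul_assoc, ht, hr2, mul_inv]
          field_simp
        rw [this]
        field_simp [hk.ne]
        ring) (by simp [hsk, hk.ne])
      simpa using h1
    have h1 := hnull r rfl
    -- The two signs separate the components of `b` along `k` and along `s`.
    have h2 := hnull (-r) (by ring)
    have h3 : r * B s b = 0 := by linarith
    have h4 : (B k k)⁻¹ * B k b = 0 := by linarith
    exact ⟨(mul_eq_zero.1 h4).resolve_left (inv_ne_zero hk.ne), (mul_eq_zero.1 h3).resolve_left hr0⟩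
  obtain ⟨s, hs, hs0⟩ : ∃ s, B k s = 0 ∧ s ≠ 0 := by
    by_contra! hcon
    have hinj : Function.Injective (B k : E →ₗ[ℝ] ℝ) :=
      (injective_iff_map_eq_zero _).2 fun s hs ↦ hcon s hs
    have := LinearMap.finrank_le_finrank_of_injective hinj
    simp at this
    omega
  have hkb := (key s hs hs0).1
  by_contra hb
  -- Now `b` is orthogonal to `k`, so `key` applies with `s = b` and gives `B b b = 0`.
  exact (hB.pos_of_orthogonal hk hkb hb).ne' (key b hkb hb).2

/-- Coordinates on the product in which the null congruence of `k` is an affine slice. -/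
theorem exists_constraint_chart {G : E → E →L[ℝ] E →L[ℝ] ℝ} {k : E → E} {T : Set E} {x₀ a₀ : E}
    (hT : IsOpen T) (hx₀ : x₀ ∈ T) (hG : ContDiffOn ℝ ∞ G T) (hk : ContDiffOn ℝ ∞ k T)
    (hL : IsLorentzianForm (G x₀)) (ha : G x₀ a₀ a₀ = 0) (hak : G x₀ a₀ (k x₀) = -1)
    {m : ℕ} (hm : Module.finrank ℝ E = m + 2) :
    ∃ (P : E →L[ℝ] EuclideanSpace ℝ (Fin m))
      (e : OpenPartialHomeomorph (E × E) (E × ℝ × ℝ × EuclideanSpace ℝ (Fin m))),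
      (x₀, a₀) ∈ e.source ∧ (∀ z ∈ e.source, z.1 ∈ T) ∧
      (∀ z, e z = (z.1, G z.1 z.2 z.2, G z.1 z.2 (k z.1), P z.2)) ∧
      ContDiffOn ℝ ∞ e.symm e.target := by
  obtain ⟨P, hP⟩ := exists_projection ha hak hm
  let Ψ : E × E → E × ℝ × ℝ × EuclideanSpace ℝ (Fin m) :=
    fun z ↦ (z.1, G z.1 z.2 z.2, G z.1 z.2 (k z.1), P z.2)
  have hO : IsOpen (T ×ˢ (Set.univ : Set E)) := hT.prod isOpen_univ
  have hmaps : Set.MapsTo (Prod.fst : E × E → E) (T ×ˢ (Set.univ : Set E)) T := fun z hz ↦ hz.1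
  have hG' := hG.comp contDiffOn_fst hmaps
  have hk' := hk.comp contDiffOn_fst hmaps
  have hΨ : ContDiffOn ℝ ∞ Ψ (T ×ˢ (Set.univ : Set E)) :=
    contDiffOn_fst.prodMk (((hG'.clm_apply contDiffOn_snd).clm_apply contDiffOn_snd).prodMk
      (((hG'.clm_apply contDiffOn_snd).clm_apply hk').prodMk
        (P.contDiff.comp_contDiffOn contDiffOn_snd)))
  have hGd : HasFDerivAt (fun z : E × E ↦ G z.1) _ (x₀, a₀) :=
    (((hG.contDiffAt (hT.mem_nhds hx₀)).differentiableAt (by simp)).hasFDerivAt).comp (x₀, a₀)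
      hasFDerivAt_fst
  have hkd : HasFDerivAt (fun z : E × E ↦ k z.1) _ (x₀, a₀) :=
    (((hk.contDiffAt (hT.mem_nhds hx₀)).differentiableAt (by simp)).hasFDerivAt).comp (x₀, a₀)
      hasFDerivAt_fst
  have hsnd : HasFDerivAt (fun z : E × E ↦ z.2) _ (x₀, a₀) := hasFDerivAt_snd (𝕜 := ℝ)
  have hd : HasFDerivAt Ψ _ (x₀, a₀) :=
    (hasFDerivAt_fst (𝕜 := ℝ)).prodMk (((hGd.clm_apply hsnd).clm_apply hsnd).prodMk
      (((hGd.clm_apply hsnd).clm_apply hkd).prodMk (P.hasFDerivAt.comp (x₀, a₀) hsnd)))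
  -- A kernel vector has no base part, so the derivatives of the metric and of `k` disappear; its
  -- fibre part is orthogonal to `a₀` and `k x₀`, and is killed by `P`.
  have hinj : Function.Injective (fderiv ℝ Ψ (x₀, a₀)).toLinearMap := by
    refine (injective_iff_map_eq_zero _).2 fun ⟨x, b⟩ hb ↦ ?_
    rw [hd.fderiv] at hb
    have hx : x = 0 := congrArg Prod.fst hb
    subst hx
    simp [hL.symm b a₀] at hb
    obtain ⟨h1, h2, h3⟩ := hb
    rw [hP b h1 h2 h3]
    rfl
  obtain ⟨e, he1, he2, he3, he4⟩ := exists_openPartialHomeomorph hO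
    (x₀ := (x₀, a₀)) ⟨hx₀, trivial⟩ hΨ
    ⟨(LinearMap.linearEquivOfInjective _ hinj (by simp; omega)).toContinuousLinearEquiv, by
      exact ContinuousLinearMap.ext fun z ↦ rfl⟩
  exact ⟨P, e, he1, fun z hz ↦ (he2 hz).1, fun z ↦ by rw [he3], he4⟩

end LinearAlgebra

/-! ### Parametrizations of the null congruence and the consequence of total geodesy. -/

section Existence

variable {n : ℕ} {M : Type*} [TopologicalSpace M] [ChartedSpace (EuclideanSpace ℝ (Fin n)) M]
  [IsManifold (𝓡 n) ∞ M] {g : LorentzianMetric n M} {K : ∀ p : M, TangentSpace (𝓡 n) p}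

/-- The null congruence can be parametrized around any of its points, in such a way that a constant
vector field is vertical. -/
theorem exists_isLocalParametrization (hn : 3 ≤ n)
    (hK : ContMDiff (𝓡 n) (𝓡 n).tangent ∞
      (fun p ↦ (TotalSpace.mk p (K p) : TangentBundle (𝓡 n) M)))
    {v : TangentBundle (𝓡 n) M} (hv : v ∈ g.nullCongruence K) :
    ∃ (W : Set (EuclideanSpace ℝ (Fin (2 * (n - 1)))))
      (φ : EuclideanSpace ℝ (Fin (2 * (n - 1))) → TangentBundle (𝓡 n) M)
      (w u : EuclideanSpace ℝ (Fin (2 * (n - 1)))),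
      IsLocalParametrization (𝓡 n).tangent (g.nullCongruence K) W φ ∧ w ∈ W ∧ φ w = v ∧ u ≠ 0 ∧
        ∀ y ∈ W, IsVertical φ y u := by
  set p := v.proj with hpdef
  have hp : v.proj ∈ (extChartAt (𝓡 n) p).source := mem_extChartAt_source _
  obtain ⟨P, e, he₀, heT, he, hes⟩ := exists_constraint_chart (G := g.inChart p)
    (k := fieldInChart K p) (m := n - 2) (x₀ := extChartAt (𝓡 n) p v.proj)
    (a₀ := components p v.proj v.snd)
    (isOpen_extChartAt_target p) ((extChartAt (𝓡 n) p).map_source hp)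
    (g.contDiffOn_inChart p) (contDiffOn_fieldInChart hK p) (g.inChart_isLorentzianForm hp)
    (by rw [← g.form_eq_inChart hp]; exact hv.1)
    (by rw [fieldInChart_extChartAt hp, ← g.form_eq_inChart hp]; exact hv.2)
    (by simp; omega)
  let c : OpenPartialHomeomorph (TangentBundle (𝓡 n) M)
    (EuclideanSpace ℝ (Fin n) × EuclideanSpace ℝ (Fin n)) :=
    chartAt (ModelProd (EuclideanSpace ℝ (Fin n)) (EuclideanSpace ℝ (Fin n))) v
  have hcs : ∀ v', v' ∈ c.source ↔ v'.proj ∈ (extChartAt (𝓡 n) p).source := fun v' ↦ by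
    rw [extChartAt_source]
    exact TangentBundle.mem_chart_source_iff v' v
  have hc : ∀ v' ∈ c.source, c v' = (extChartAt (𝓡 n) p v'.proj, components p v'.proj v'.snd) := by
    intro v' hv'
    exact Prod.ext rfl (components_eq_trivializationAt v' ((hcs v').1 hv')).symm
  let h := c ≫ₕ e
  have hsrc : ∀ v' ∈ h.source, v'.proj ∈ (extChartAt (𝓡 n) p).source := fun v' hv' ↦ by
    rw [OpenPartialHomeomorph.trans_source] at hv'
    exact (hcs v').1 hv'.1
  have hval : ∀ v' ∈ h.source, h v' = (extChartAt (𝓡 n) p v'.proj,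
      g.form v'.proj v'.snd v'.snd, g.form v'.proj v'.snd (K v'.proj),
        P (components p v'.proj v'.snd)) := by
    intro v' hv'
    have h1 := hsrc v' hv'
    rw [OpenPartialHomeomorph.coe_trans, Function.comp_apply, he, hc v' ((hcs v').2 h1),
      fieldInChart_extChartAt h1, ← g.form_eq_inChart h1, ← g.form_eq_inChart h1]
  let L : EuclideanSpace ℝ (Fin (2 * (n - 1))) ≃L[ℝ]
      EuclideanSpace ℝ (Fin n) × EuclideanSpace ℝ (Fin (n - 2)) :=
    ContinuousLinearEquiv.ofFinrankEq (by simp; omega)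
  -- The values `0` and `-1` are those of the two constraints on the congruence; the free
  -- coordinates number `n + (n - 2)`.
  let ι : EuclideanSpace ℝ (Fin (2 * (n - 1))) →
      EuclideanSpace ℝ (Fin n) × ℝ × ℝ × EuclideanSpace ℝ (Fin (n - 2)) :=
    fun w ↦ ((L w).1, 0, -1, (L w).2)
  have hιs : ContDiff ℝ ∞ ι :=
    (contDiff_fst.comp L.contDiff).prodMk (contDiff_const.prodMk (contDiff_const.prodMk
      (contDiff_snd.comp L.contDiff)))
  have hι : Topology.IsEmbedding ι := by
    refine Topology.IsEmbedding.of_leftInverse (f := fun z ↦ L.symm (z.1, z.2.2.2)) (fun w ↦ ?_) ?_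
      hιs.continuous
    · simp [ι]
    · fun_prop
  have hS : ∀ v' ∈ h.source, v' ∈ g.nullCongruence K ↔ h v' ∈ Set.range ι := by
    intro v' hv'
    rw [hval v' hv']
    constructor
    · rintro ⟨h1, h2⟩
      exact ⟨L.symm (extChartAt (𝓡 n) p v'.proj, P (components p v'.proj v'.snd)), by
        simp [ι, h1, h2]⟩
    · rintro ⟨w, hw⟩
      exact ⟨(congrArg (fun z ↦ z.2.1) hw).symm, (congrArg (fun z ↦ z.2.2.1) hw).symm⟩
  set φ := h.symm ∘ ι with hφ
  have hφs : ∀ y ∈ ι ⁻¹' h.target, φ y ∈ h.source := fun y hy ↦ h.map_target hy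
  have hφι : ∀ y ∈ ι ⁻¹' h.target, h (φ y) = ι y := fun y hy ↦ h.right_inv hy
  have hm : Set.MapsTo φ (ι ⁻¹' h.target) (g.nullCongruence K) := fun y hy ↦
    (hS _ (hφs y hy)).2 ⟨y, (hφι y hy).symm⟩
  have hWo : IsOpen (ι ⁻¹' h.target) := h.open_target.preimage hιs.continuous
  have hcoord : ∀ y ∈ ι ⁻¹' h.target,
      (baseCoord p φ y, fibreCoord p φ y) = e.symm (ι y) := by
    intro y hy
    have h1 : φ y ∈ c.source := (hcs _).2 (hsrc _ (hφs y hy))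
    rw [baseCoord, fibreCoord, ← hc _ h1]
    refine c.right_inv ?_
    have := hy
    rw [Set.mem_preimage, OpenPartialHomeomorph.trans_target] at this
    exact this.2
  have hsm : ContDiffOn ℝ ∞ (fun y ↦ e.symm (ι y)) (ι ⁻¹' h.target) := by
    refine hes.comp hιs.contDiffOn fun y hy ↦ ?_
    rw [Set.mem_preimage, OpenPartialHomeomorph.trans_target] at hy
    exact hy.1
  have hbs : ContDiffOn ℝ ∞ (baseCoord p φ) (ι ⁻¹' h.target) :=
    (contDiff_fst.comp_contDiffOn hsm).congr fun y hy ↦ congrArg Prod.fst (hcoord y hy)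
  have hfs : ContDiffOn ℝ ∞ (fibreCoord p φ) (ι ⁻¹' h.target) :=
    (contDiff_snd.comp_contDiffOn hsm).congr fun y hy ↦ congrArg Prod.snd (hcoord y hy)
  have hφat : ∀ y ∈ ι ⁻¹' h.target, ContMDiffAt 𝓘(ℝ, EuclideanSpace ℝ (Fin (2 * (n - 1))))
      (𝓡 n).tangent ∞ φ y := by
    intro y hy
    have hy1 := hsrc _ (hφs y hy)
    rw [contMDiffAt_tangentBundle_iff hy1]
    refine ⟨?_, hfs.contDiffAt (hWo.mem_nhds hy)⟩
    have h1 : ContMDiffAt 𝓘(ℝ, EuclideanSpace ℝ (Fin n)) (𝓡 n) ∞ (extChartAt (𝓡 n) p).symm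
        (baseCoord p φ y) := (contMDiffOn_extChartAt_symm p).contMDiffAt
      ((isOpen_extChartAt_target p).mem_nhds ((extChartAt (𝓡 n) p).map_source hy1))
    refine (h1.comp y (hbs.contDiffAt (hWo.mem_nhds hy)).contMDiffAt).congr_of_eventuallyEq ?_
    filter_upwards [hWo.mem_nhds hy] with y' hy'
    exact ((extChartAt (𝓡 n) p).left_inv (hsrc _ (hφs y' hy'))).symm
  have hLy : ∀ y ∈ ι ⁻¹' h.target, L y = (baseCoord p φ y, P (fibreCoord p φ y)) := by
    intro y hy
    have h1 := hφι y hy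
    rw [hval _ (hφs y hy)] at h1
    exact Prod.ext (congrArg Prod.fst h1).symm (congrArg (fun z ↦ z.2.2.2) h1).symm
  -- The base derivative and `P` of the fibre derivative recover `u`. Hence `φ` is an immersion, and
  -- directions with zero first component are vertical.
  have hLd : ∀ y ∈ ι ⁻¹' h.target, ∀ u,
      L u = (fderiv ℝ (baseCoord p φ) y u, P (fderiv ℝ (fibreCoord p φ) y u)) := by
    intro y hy u
    have h1 : HasFDerivAt (fun y ↦ (baseCoord p φ y, P (fibreCoord p φ y))) _ y :=
      ((hbs.contDiffAt (hWo.mem_nhds hy)).differentiableAt (by simp)).hasFDerivAt.prodMk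
        (P.hasFDerivAt.comp y
          ((hfs.contDiffAt (hWo.mem_nhds hy)).differentiableAt (by simp)).hasFDerivAt)
    have h2 : (L : _ → _) =ᶠ[𝓝 y] fun y ↦ (baseCoord p φ y, P (fibreCoord p φ y)) := by
      filter_upwards [hWo.mem_nhds hy] with y' hy' using hLy y' hy'
    exact DFunLike.congr_fun ((L.hasFDerivAt (x := y)).unique (h1.congr_of_eventuallyEq h2)) u
  have hvs : v ∈ h.source := by
    rw [OpenPartialHomeomorph.trans_source]
    refine ⟨(hcs v).2 hp, ?_⟩
    rw [Set.mem_preimage, hc v ((hcs v).2 hp)]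
    exact he₀
  obtain ⟨w, hw⟩ := (hS v hvs).1 hv
  -- Here `n ≥ 3` is indispensable: the fibres have dimension `n - 2`.
  have : Nontrivial (EuclideanSpace ℝ (Fin (n - 2))) := by
    have : Nonempty (Fin (n - 2)) := ⟨⟨0, by omega⟩⟩
    infer_instance
  obtain ⟨s, hs⟩ := exists_ne (0 : EuclideanSpace ℝ (Fin (n - 2)))
  refine ⟨ι ⁻¹' h.target, φ, w, L.symm (0, s), ⟨hWo, fun y hy ↦ (hφat y hy).contMDiffWithinAt, ?_,
    hm, isOpenEmbedding_slice h hι hS hm⟩, ?_, ?_, ?_, ?_⟩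
  · intro y hy
    refine (injective_iff_map_eq_zero _).2 fun u hu ↦ ?_
    have hy1 := hsrc _ (hφs y hy)
    have h1 := components_dproj (hφat y hy) hy1 u
    have h2 := mvfderiv_components (hφat y hy) hy1 u
    rw [hu, map_zero] at h2
    rw [hu, map_zero, map_zero] at h1
    have h3 := hLd y hy u
    rw [← h1, ← h2, map_zero] at h3
    exact L.map_eq_zero_iff.1 h3
  · rw [Set.mem_preimage, hw]
    exact h.map_source hvs
  · rw [hφ, Function.comp_apply, hw, h.left_inv hvs]
  · intro h0
    rw [L.symm.map_eq_zero_iff] at h0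
    exact hs (congrArg Prod.snd h0)
  · intro y hy
    rw [isVertical_iff (hφat y hy) (hsrc _ (hφs y hy))]
    have := hLd y hy (L.symm (0, s))
    rw [L.apply_symm_apply] at this
    exact (congrArg Prod.fst this).symm

/-- If the fibres are totally geodesic, the covariant derivative of `K` is orthogonal to the null
congruence. -/
theorem LorentzianMetric.FibresTotallyGeodesic.covDeriv_orthogonal
    (H : g.FibresTotallyGeodesic K) (hn : 3 ≤ n)
    (hK : ContMDiff (𝓡 n) (𝓡 n).tangent ∞
      (fun p ↦ (TotalSpace.mk p (K p) : TangentBundle (𝓡 n) M)))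
    (hKt : g.IsTimelike K) {v : TangentBundle (𝓡 n) M} (hv : v ∈ g.nullCongruence K)
    (d : EuclideanSpace ℝ (Fin n)) :
    g.inChart v.proj (extChartAt (𝓡 n) v.proj v.proj) (components v.proj v.proj v.snd)
      (covDeriv (g.inChart v.proj) (fieldInChart K v.proj) (extChartAt (𝓡 n) v.proj v.proj) d) =
        0 := by
  obtain ⟨W, φ, w, u, hφ, hw, rfl, hu0, huv⟩ := exists_isLocalParametrization hn hK hv
  have hI := hφ.isNullImmersion (by omega) hK hKt hw
  have hφw := hφ.contMDiffOn.contMDiffAt (hφ.isOpen.mem_nhds hw)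
  have hp := mem_extChartAt_source (I := 𝓡 n) (φ w).proj
  have hu := (isVertical_iff hφw hp u).1 (huv w hw)
  -- The horizontal lift of `d`, with connection part `g(a, ∇_d K) a`.
  obtain ⟨z, hzd, hzc⟩ := hI.exists_tangent d
    (g.inChart (φ w).proj (baseCoord (φ w).proj φ w) (fibreCoord (φ w).proj φ w)
      (covDeriv (g.inChart (φ w).proj) (fieldInChart K (φ w).proj) (baseCoord (φ w).proj φ w) d) •
        fibreCoord (φ w).proj φ w) (by simp [hI.null_self]) (by simp [hI.normalized_self])
  have hz : g.IsHorizontal φ w z := by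
    intro u' hu'
    rw [g.pullbackForm_sasaki_eq hφw hp, sasakiAlong, add_apply, add_apply, pullbackBilin_apply,
      pullbackBilin_apply, (isVertical_iff hφw hp u').1 hu', hzc, map_smul, hI.lorentzian.symm _
      (fibreCoord _ _ _), hI.null_covDerivAlong]
    simp
  have h := H W φ hφ (fun _ ↦ u) contDiffOn_const huv w hw u (huv w hw) z hz
  rw [hφ.pullbackForm_covDeriv (by omega) hK hKt contDiffOn_const huv hw (huv w hw) hz, hzd,
    neg_eq_zero, mul_eq_zero] at h
  -- The other factor is `g(c u, c u)`, positive because `c u` is nonzero and orthogonal to `K`.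
  refine h.resolve_left (ne_of_gt ?_)
  refine hI.lorentzian.pos_of_orthogonal hI.timelike ?_ fun h0 ↦ hu0 (hI.immersion u hu h0)
  rw [hI.lorentzian.symm, ← IsNullImmersion.covDerivAlong_of_vertical hu, hI.field_covDerivAlong, hu]
  simp

end Existence

end

end NullCongruence

/-! ### The equivalence. -/

theorem mainTheorem7 {n : ℕ} (hn : 3 ≤ n) {M : Type*} [TopologicalSpace M]
    [ChartedSpace (EuclideanSpace ℝ (Fin n)) M] [IsManifold (𝓡 n) ∞ M]
    (g : NullCongruence.LorentzianMetric n M)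
    (K : ∀ p : M, TangentSpace (𝓡 n) p)
    (hK_smooth : ContMDiff (𝓡 n) (𝓡 n).tangent ∞
      (fun p ↦ (TotalSpace.mk p (K p) : TangentBundle (𝓡 n) M)))
    (hK_timelike : g.IsTimelike K) :
    g.FibresTotallyGeodesic K ↔ g.IsParallel K := by
  refine ⟨fun H ↦ g.isParallel_iff.2 fun p d ↦ ?_, fun H W φ hφ U hU hUv w hw u hu z hz ↦ ?_⟩
  · have hp := mem_extChartAt_source (I := 𝓡 n) p
    have hk := hK_timelike p
    rw [g.form_eq_inChart hp] at hk
    -- It suffices to pair `∇_d K` with normalized null vectors `a`, each of which is the component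
    -- vector of a point of the congruence over `p`.
    refine (g.inChart_isLorentzianForm hp).eq_zero_of_null hk (by simp; omega) fun a ha hak ↦ ?_
    obtain ⟨e, he⟩ := NullCongruence.components_isInvertible hp
    have hea : NullCongruence.components p p (e.symm a) = a := by
      rw [← he]
      exact e.apply_symm_apply a
    have h := H.covDeriv_orthogonal hn hK_smooth hK_timelike
      (v := (TotalSpace.mk p (e.symm a) : TangentBundle (𝓡 n) M))
      ⟨by rw [g.form_eq_inChart hp]; simp only [hea]; exact ha,
        by rw [g.form_eq_inChart hp]; simp only [hea]; exact hak⟩ d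
    simp only [hea] at h
    exact h
  · rw [hφ.pullbackForm_covDeriv (by omega) hK_smooth hK_timelike hU hUv hw hu hz]
    have h := g.isParallel_iff.1 H (φ w).proj (fderiv ℝ (NullCongruence.baseCoord (φ w).proj φ) w z)
    rw [NullCongruence.baseCoord, h]
    simp
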